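/- Let $p\ge 1$ and $n>p$, let $\mathcal H^*_p=\{\theta\in\mathbb R^p:\theta_p\ge 0\}$, and let $\mathcal C\subseteq\mathcal H^*_p$ be a closed convex cone containing a nonempty open subset of $\mathbb R^p$. Let $X_1,\dots,X_n$ be i.i.d. $N_p(\theta,\Sigma)$ with $\Sigma$ unknown and positive definite, write $P_{\theta,\Sigma}$ for their law, and put $$\bar X_n=\frac1n\sum_{i=1}^n X_i,\qquad S_n=\frac1{n-1}\sum_{i=1}^n (X_i-\bar X_n)(X_i-\bar X_n)'.$$ For $\mathcal K\in\{\mathcal C,\mathcal H^*_p\}$ the union-intersection test (UIT) of $H_0:\theta=0$ against $H_1:\theta\in\mathcal K\setminus\{0\}$ with critical value $c>0$ rejects $H_0$ when $U_{\mathcal K}\ge c$, where $$U_{\mathcal K}=\bigl\|\pi_{S_n}(\sqrt n\,\bar X_n;\mathcal K)\bigr\|_{S_n}^2,$$ $\|x\|_A^2=x'A^{-1}x$, and $\pi_A(x;\mathcal K)$ is the orthogonal projection of $x$ onto $\mathcal K$ (the point of $\mathcal K$ nearest to $x$) in the norm $\|\cdot\|_A$; $S_n$ is positive definite with probability one. For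 $0<\alpha<1$, call $c>0$ a critical value of level $\alpha$ for $\mathcal K$ if $$\sup_{\Sigma\text{ positive definite}}P_{0,\Sigma}\{U_{\mathcal K}\ge c\}=\alpha .$$ **Proposition 3.1.** Let $0<\alpha<1$. If $p\ge 2$, or if $p=1$ and $\alpha<\tfrac12$, then each of $\mathcal C$ and $\mathcal H^*_p$ has exactly one critical value of level $\alpha$. Whenever $c$ and $c^*$ are critical values of level $\alpha$ for $\mathcal C$ and $\mathcal H^*_p$ respectively, the UIT against $\mathcal C\setminus\{0\}$ is dominated by the UIT against $\mathcal H^*_p\setminus\{0\}$, that is, $$P_{\theta,\Sigma}\{U_{\mathcal C}\ge c\}\le P_{\theta,\Sigma}\{U_{\mathcal H^*_p}\ge c^*\}\qquad\text{for all }\theta\in\mathbb R^p\text{ and all positive definite }\Sigma,$$ and, if $\mathcal C\ne\mathcal H^*_p$, the inequality is strict for some $\theta\in\mathcal C\setminus\{0\}$ and some positive definite $\Sigma$. -/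

import Mathlib

open MeasureTheory ProbabilityTheory Matrix

namespace OneSidedNormal

noncomputable section

/-- The halfspace `{θ ∈ ℝᵖ | θ_p ≥ 0}` determined by the last coordinate. -/
def halfSpace (p : ℕ) [NeZero p] : Set (EuclideanSpace ℝ (Fin p)) :=
  {θ | 0 ≤ θ ⟨p - 1, Nat.sub_one_lt (NeZero.ne p)⟩}

/-- The law of an i.i.d. sample `X₁, …, Xₙ` from the normal distribution `N_p(θ, Σ)`. -/
def sampleLaw {p : ℕ} (n : ℕ) (θ : EuclideanSpace ℝ (Fin p)) (Sg : Matrix (Fin p) (Fin p) ℝ) :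
    Measure (Fin n → EuclideanSpace ℝ (Fin p)) :=
  Measure.pi fun _ => multivariateGaussian θ Sg

/-- The sample mean `n⁻¹ ∑ₖ Xₖ`. -/
def sampleMean {p n : ℕ} (X : Fin n → EuclideanSpace ℝ (Fin p)) : EuclideanSpace ℝ (Fin p) :=
  (n : ℝ)⁻¹ • ∑ k, X k

/-- The sample covariance matrix `(n - 1)⁻¹ ∑ₖ (Xₖ - X̄) (Xₖ - X̄)'`. -/
def sampleCov {p n : ℕ} (X : Fin n → EuclideanSpace ℝ (Fin p)) : Matrix (Fin p) (Fin p) ℝ :=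
  ((n : ℝ) - 1)⁻¹ • ∑ k, vecMulVec (X k - sampleMean X).ofLp (X k - sampleMean X).ofLp

/-- The squared norm `‖x‖²_A = x' A⁻¹ x` of the inner product `⟨x, y⟩_A = x' A⁻¹ y`. -/
def sqNorm {p : ℕ} (A : Matrix (Fin p) (Fin p) ℝ) (x : EuclideanSpace ℝ (Fin p)) : ℝ :=
  x.ofLp ⬝ᵥ (A⁻¹ *ᵥ x.ofLp)

/-- `y` is an orthogonal projection of `x` onto `C` for the inner product `⟨·, ·⟩_A`:
a point of `C` nearest to `x`. -/
def IsProj {p : ℕ} (A : Matrix (Fin p) (Fin p) ℝ) (C : Set (EuclideanSpace ℝ (Fin p)))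
    (x y : EuclideanSpace ℝ (Fin p)) : Prop :=
  y ∈ C ∧ ∀ z ∈ C, sqNorm A (x - y) ≤ sqNorm A (x - z)

/-- The projection `π_A(x; C)`. For positive definite `A` and nonempty closed convex `C` it is
the unique point satisfying `IsProj A C x`. -/
def proj {p : ℕ} (A : Matrix (Fin p) (Fin p) ℝ) (C : Set (EuclideanSpace ℝ (Fin p)))
    (x : EuclideanSpace ℝ (Fin p)) : EuclideanSpace ℝ (Fin p) :=
  Classical.epsilon (IsProj A C x)

/-- The union-intersection statistic `‖π_S(√n X̄; C)‖²_S` for `θ = 0` against `θ ∈ C \ {0}`,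
where `S` is the sample covariance matrix. -/
def uitStat {p n : ℕ} (C : Set (EuclideanSpace ℝ (Fin p)))
    (X : Fin n → EuclideanSpace ℝ (Fin p)) : ℝ :=
  sqNorm (sampleCov X) (proj (sampleCov X) C (√(n : ℝ) • sampleMean X))

/-- The rejection probability at `(θ, Σ)` of the test that rejects `θ = 0` when the
union-intersection statistic for `C` is at least `c`. -/
def power {p : ℕ} (n : ℕ) (C : Set (EuclideanSpace ℝ (Fin p))) (c : ℝ)
    (θ : EuclideanSpace ℝ (Fin p)) (Sg : Matrix (Fin p) (Fin p) ℝ) : ℝ :=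
  (sampleLaw n θ Sg).real {X | c ≤ uitStat C X}

/-- `c > 0` is a critical value of level `α`: the supremum over all positive definite `Σ` of the
null rejection probability equals `α`. -/
def IsCriticalValue {p : ℕ} (n : ℕ) (C : Set (EuclideanSpace ℝ (Fin p))) (α c : ℝ) : Prop :=
  0 < c ∧ IsLUB {r | ∃ Sg : Matrix (Fin p) (Fin p) ℝ, Sg.PosDef ∧ r = power n C c 0 Sg} α

end

end OneSidedNormal

namespace OneSidedNormal

/-! For a closed cone `K`, the squared length of the projection of `x` is the maximum over `z ∈ K`
of `2⟨x, z⟩ - ⟨z, z⟩` (`isGreatest_gain`). The statistic is therefore monotone in `K`, and at a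
common critical value the test against the smaller cone rejects less often, whatever `θ` and `Σ`
are. It remains to see that both tests have the same critical value.

For the halfspace the null rejection probability does not depend on `Σ`: write `Σ = D D'` with `D`
preserving the halfspace, and use the equivariance of mean and covariance (`power_halfSpace_zero`).
For `C` it may depend on `Σ`, and is bounded by the value for the halfspace. This bound is the
supremum (`isLUB_power_cone`): let `D` fix an interior point `a` of `C` and contract the boundary
hyperplane by `ε`. As `ε → 0`, the cone `D⁻¹ C` eventually contains each point of the open
halfspace.

The common null tail is strictly decreasing in `c > 0` and has no jumps there, because the statistic
has no positive atoms. This gives uniqueness, and existence by the intermediate value theorem. The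
only obstruction to existence is the mass at `0`, which vanishes for `p ≥ 2` and is at most `1/2` in
general. If `C` is not the halfspace, some nonempty open set of samples is rejected by the halfspace
test only, and a Gaussian law charges it (`power_lt_power_halfSpace`). -/

variable {p n : ℕ}

/-- The inner product `⟨x, y⟩_A = x' A⁻¹ y`. -/
noncomputable def ip (A : Matrix (Fin p) (Fin p) ℝ) (x y : EuclideanSpace ℝ (Fin p)) : ℝ :=
  x.ofLp ⬝ᵥ (A⁻¹ *ᵥ y.ofLp)

/-- The decrease `‖x‖²_A - ‖x - z‖²_A` of the squared distance to `x` from `0` to `z`. -/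
noncomputable def gain (A : Matrix (Fin p) (Fin p) ℝ) (x z : EuclideanSpace ℝ (Fin p)) : ℝ :=
  2 * ip A x z - ip A z z

/-! ### Projection onto a closed cone as a maximization of the gain -/

section ip

variable {A : Matrix (Fin p) (Fin p) ℝ} (x y z : EuclideanSpace ℝ (Fin p)) (t : ℝ)

lemma sqNorm_eq_ip : sqNorm A x = ip A x x := rfl

lemma ip_add_right : ip A x (y + z) = ip A x y + ip A x z := by
  simp [ip, mulVec_add, dotProduct_add]

lemma ip_sub_left : ip A (x - y) z = ip A x z - ip A y z := by
  simp [ip, sub_dotProduct]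

lemma ip_sub_right : ip A x (y - z) = ip A x y - ip A x z := by
  simp [ip, mulVec_sub, dotProduct_sub]

lemma ip_smul_left : ip A (t • x) y = t * ip A x y := by
  simp [ip, smul_dotProduct]

lemma ip_smul_right : ip A x (t • y) = t * ip A x y := by
  simp [ip, mulVec_smul, dotProduct_smul]

variable {x y z t}

lemma ip_comm (hA : A.PosDef) : ip A x y = ip A y x := by
  have h : (A⁻¹)ᵀ = A⁻¹ := by simpa using hA.inv.isHermitian.eq
  rw [ip, ip, dotProduct_comm, dotProduct_mulVec, ← mulVec_transpose, h, dotProduct_comm,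
    dotProduct_comm]

lemma ip_self_pos (hA : A.PosDef) (hx : x ≠ 0) : 0 < ip A x x := by
  have := hA.inv.dotProduct_mulVec_pos (x := x.ofLp) (by simpa using hx)
  simpa [ip] using this

lemma ip_self_nonneg (hA : A.PosDef) : 0 ≤ ip A x x := by
  rcases eq_or_ne x 0 with rfl | hx
  · simp [ip]
  · exact (ip_self_pos hA hx).le

lemma gain_eq_sqNorm_sub (hA : A.PosDef) : gain A x z = sqNorm A x - sqNorm A (x - z) := by
  simp only [gain, sqNorm_eq_ip, ip_sub_left, ip_sub_right, ip_comm hA (x := z) (y := x)]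
  ring

lemma continuous_gain (A : Matrix (Fin p) (Fin p) ℝ) (x : EuclideanSpace ℝ (Fin p)) :
    Continuous fun z => gain A x z := by
  unfold gain ip; fun_prop

/-- The inverse of a singular matrix is `0` by convention. Degenerate samples thus have statistic
`0` and never reject at a positive critical value. -/
lemma sqNorm_eq_zero_of_not_posDef (hA : A.PosSemidef) (h : ¬ A.PosDef)
    (x : EuclideanSpace ℝ (Fin p)) : sqNorm A x = 0 := by
  have : A⁻¹ = 0 := nonsing_inv_apply_not_isUnit _ (by
    rw [hA.posDef_iff_det_ne_zero, not_not] at h; simp [h])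
  simp [sqNorm, this]

-- A factorization `A⁻¹ = B' B` turns nearest points for `A` into Euclidean nearest points.
open scoped MatrixOrder in
lemma sqNorm_eq_norm_sq (hA : A.PosDef) : ∃ L : EuclideanSpace ℝ (Fin p) ≃L[ℝ]
    EuclideanSpace ℝ (Fin p), ∀ x, sqNorm A x = ‖L x‖ ^ 2 := by
  obtain ⟨B, hB⟩ := CStarAlgebra.nonneg_iff_eq_star_mul_self.mp hA.inv.posSemidef.nonneg
  have hBB : ∀ x : EuclideanSpace ℝ (Fin p),
      sqNorm A x = ‖toEuclideanCLM (𝕜 := ℝ) B x‖ ^ 2 := by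
    intro x
    rw [EuclideanSpace.real_norm_sq_eq, sqNorm, hB, ← mulVec_mulVec, dotProduct_mulVec,
      star_eq_conjTranspose, conjTranspose_eq_transpose_of_trivial, vecMul_transpose]
    simp [dotProduct, sq, ofLp_toEuclideanCLM]
  have hinj : Function.Injective (toEuclideanCLM (𝕜 := ℝ) B) := by
    refine (injective_iff_map_eq_zero _).2 fun x hx => ?_
    by_contra h
    have := ip_self_pos hA h
    rw [← sqNorm_eq_ip, hBB, hx] at this
    simp at this
  refine ⟨ContinuousLinearEquiv.ofBijective _ (LinearMap.ker_eq_bot.2 hinj)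
    (LinearMap.range_eq_top.2 (LinearMap.injective_iff_surjective.1 hinj)), fun x => ?_⟩
  simpa using hBB x

lemma exists_isProj (hA : A.PosDef) {K : Set (EuclideanSpace ℝ (Fin p))} (hK : IsClosed K)
    (hne : K.Nonempty) (x : EuclideanSpace ℝ (Fin p)) : ∃ y, IsProj A K x y := by
  obtain ⟨L, hL⟩ := sqNorm_eq_norm_sq hA
  have hcl : IsClosed (L '' K) := L.toHomeomorph.isClosedMap _ hK
  obtain ⟨w, ⟨y, hy, rfl⟩, hw⟩ := hcl.exists_infDist_eq_dist (hne.image L) (L x)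
  refine ⟨y, hy, fun z hz => ?_⟩
  have := Metric.infDist_le_dist_of_mem (x := L x) (Set.mem_image_of_mem L hz)
  rw [hw, dist_eq_norm, dist_eq_norm, ← map_sub, ← map_sub] at this
  rw [hL, hL]
  gcongr

/-- The squared length of the projection onto a closed cone is the largest gain over the cone. -/
lemma isGreatest_gain (hA : A.PosDef) {K : Set (EuclideanSpace ℝ (Fin p))} (hK : IsClosed K)
    (hne : K.Nonempty) (hcone : ∀ t : ℝ, 0 < t → ∀ z ∈ K, t • z ∈ K)
    (x : EuclideanSpace ℝ (Fin p)) :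
    IsGreatest (gain A x '' K) (sqNorm A (proj A K x)) := by
  have hy : IsProj A K x (proj A K x) := Classical.epsilon_spec (exists_isProj hA hK hne x)
  generalize proj A K x = y at hy ⊢
  have hmax : ∀ z ∈ K, gain A x z ≤ gain A x y := fun z hz => by
    rw [gain_eq_sqNorm_sub hA, gain_eq_sqNorm_sub hA]
    linarith [hy.2 z hz]
  -- Maximality of `y` along its own ray, which stays in the cone, forces `⟨x, y⟩ = ⟨y, y⟩`. Below,
  -- `t = 1/2` gives `⟨x, y⟩ > 0`, and then the vertex `t = ⟨x, y⟩ / ⟨y, y⟩` of the parabola is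
  -- admissible.
  have hscale : ∀ t : ℝ, 0 < t → 2 * t * ip A x y - t ^ 2 * ip A y y ≤
      2 * ip A x y - ip A y y := fun t ht => by
    have := hmax _ (hcone t ht y hy.1)
    simp only [gain, ip_smul_left, ip_smul_right] at this
    linarith
  have hyy := ip_self_nonneg hA (x := y)
  have hval : ip A x y = ip A y y := by
    rcases eq_or_ne y 0 with rfl | h0
    · simp [ip]
    have hpos := ip_self_pos hA h0
    have hb : 0 < ip A x y := by linarith [hscale (1 / 2) (by norm_num)]
    have := hscale (ip A x y / ip A y y) (by positivity)
    have h2 : 2 * (ip A x y / ip A y y) * ip A x y - (ip A x y / ip A y y) ^ 2 * ip A y y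
      = ip A x y ^ 2 / ip A y y := by field_simp; ring
    rw [h2, div_le_iff₀ hpos] at this
    nlinarith [sq_nonneg (ip A x y - ip A y y)]
  have h : sqNorm A y = gain A x y := by rw [gain, hval, sqNorm_eq_ip]; ring
  rw [h]
  exact ⟨⟨y, hy.1, rfl⟩, by rintro _ ⟨z, hz, rfl⟩; exact hmax z hz⟩

end ip

/-! ### The statistic of a sample and its behaviour under linear maps -/

section sample

/-- The linear action of a matrix on an array of vectors. -/
noncomputable def act (M : Matrix (Fin p) (Fin p) ℝ) (X : Fin n → EuclideanSpace ℝ (Fin p)) :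
    Fin n → EuclideanSpace ℝ (Fin p) :=
  fun k => toEuclideanCLM (𝕜 := ℝ) M (X k)

/-- The standardized sample mean `√n X̄`. -/
noncomputable def zMean (X : Fin n → EuclideanSpace ℝ (Fin p)) : EuclideanSpace ℝ (Fin p) :=
  √(n : ℝ) • sampleMean X

lemma sampleCov_posSemidef (hn : 1 ≤ n) (X : Fin n → EuclideanSpace ℝ (Fin p)) :
    (sampleCov X).PosSemidef := by
  refine PosSemidef.smul (posSemidef_sum _ fun k _ => ?_) ?_
  · simpa using posSemidef_vecMulVec_self_star (X k - sampleMean X).ofLp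
  · have : (1 : ℝ) ≤ n := by exact_mod_cast hn
    exact inv_nonneg.2 (by linarith)

lemma uitStat_of_not_posDef (hn : 1 ≤ n) {X : Fin n → EuclideanSpace ℝ (Fin p)}
    (h : ¬ (sampleCov X).PosDef) (K : Set (EuclideanSpace ℝ (Fin p))) : uitStat K X = 0 :=
  sqNorm_eq_zero_of_not_posDef (sampleCov_posSemidef hn X) h _

/-- A closed, nonempty set which is stable under multiplication by positive scalars. -/
structure IsClosedCone (K : Set (EuclideanSpace ℝ (Fin p))) : Prop where
  isClosed : IsClosed K
  nonempty : K.Nonempty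
  smul_mem : ∀ t : ℝ, 0 < t → ∀ z ∈ K, t • z ∈ K

lemma isGreatest_uitStat {X : Fin n → EuclideanSpace ℝ (Fin p)} (hX : (sampleCov X).PosDef)
    {K : Set (EuclideanSpace ℝ (Fin p))} (hK : IsClosedCone K) :
    IsGreatest (gain (sampleCov X) (zMean X) '' K) (uitStat K X) :=
  isGreatest_gain hX hK.isClosed hK.nonempty hK.smul_mem _

/-- Since the maximum is attained, rejection becomes an existential statement over `K`, free of
projections; this is the form that transforms well under linear maps. -/
lemma le_uitStat_iff (hn : 1 ≤ n) {K : Set (EuclideanSpace ℝ (Fin p))} (hK : IsClosedCone K)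
    {c : ℝ} (hc : 0 < c) (X : Fin n → EuclideanSpace ℝ (Fin p)) :
    c ≤ uitStat K X ↔
      (sampleCov X).PosDef ∧ ∃ z ∈ K, c ≤ gain (sampleCov X) (zMean X) z := by
  by_cases h : (sampleCov X).PosDef
  · obtain ⟨⟨y, hy, hyU⟩, hub⟩ := isGreatest_uitStat h hK
    refine ⟨fun hcU => ⟨h, y, hy, hyU ▸ hcU⟩, ?_⟩
    rintro ⟨-, z, hz, hcz⟩
    exact hcz.trans (hub ⟨z, hz, rfl⟩)
  · simp [h, uitStat_of_not_posDef hn h, hc]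

lemma uitStat_nonneg (hn : 1 ≤ n) {K : Set (EuclideanSpace ℝ (Fin p))}
    (X : Fin n → EuclideanSpace ℝ (Fin p)) : 0 ≤ uitStat K X := by
  by_cases h : (sampleCov X).PosDef
  · exact ip_self_nonneg h
  · rw [uitStat_of_not_posDef hn h]

lemma uitStat_mono (hn : 1 ≤ n) {K K' : Set (EuclideanSpace ℝ (Fin p))} (hK : IsClosedCone K)
    (hK' : IsClosedCone K') (hKK : K ⊆ K') (X : Fin n → EuclideanSpace ℝ (Fin p)) :
    uitStat K X ≤ uitStat K' X := by
  by_cases h : (sampleCov X).PosDef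
  · exact (isGreatest_uitStat h hK).mono (isGreatest_uitStat h hK') (Set.image_mono hKK)
  · rw [uitStat_of_not_posDef hn h, uitStat_of_not_posDef hn h]

lemma sampleMean_act (M : Matrix (Fin p) (Fin p) ℝ) (X : Fin n → EuclideanSpace ℝ (Fin p)) :
    sampleMean (act M X) = toEuclideanCLM (𝕜 := ℝ) M (sampleMean X) := by
  simp [sampleMean, act, map_sum]

lemma zMean_act (M : Matrix (Fin p) (Fin p) ℝ) (X : Fin n → EuclideanSpace ℝ (Fin p)) :
    zMean (act M X) = toEuclideanCLM (𝕜 := ℝ) M (zMean X) := by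
  simp [zMean, sampleMean_act]

lemma sampleCov_act (M : Matrix (Fin p) (Fin p) ℝ) (X : Fin n → EuclideanSpace ℝ (Fin p)) :
    sampleCov (act M X) = M * sampleCov X * Mᵀ := by
  simp only [sampleCov, sampleMean_act, act, ← map_sub, ofLp_toEuclideanCLM, Matrix.mul_smul,
    Matrix.smul_mul, Matrix.mul_sum, Matrix.sum_mul]
  congr 1
  refine Finset.sum_congr rfl fun k _ => ?_
  rw [mul_vecMulVec, vecMulVec_mul, vecMul_transpose]

lemma gain_conj {M S : Matrix (Fin p) (Fin p) ℝ} (hM : IsUnit M.det)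
    (x z : EuclideanSpace ℝ (Fin p)) :
    gain (M * S * Mᵀ) (toEuclideanCLM (𝕜 := ℝ) M x) (toEuclideanCLM (𝕜 := ℝ) M z) =
      gain S x z := by
  have h : ∀ u v : EuclideanSpace ℝ (Fin p),
      ip (M * S * Mᵀ) (toEuclideanCLM (𝕜 := ℝ) M u) (toEuclideanCLM (𝕜 := ℝ) M v) = ip S u v := by
    intro u v
    have h1 : Mᵀ * ((M * S * Mᵀ)⁻¹ * M) = S⁻¹ := by
      rw [Matrix.mul_inv_rev, Matrix.mul_inv_rev, Matrix.mul_assoc, Matrix.mul_assoc,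
        nonsing_inv_mul _ hM, Matrix.mul_one, ← Matrix.mul_assoc,
        mul_nonsing_inv _ (by rwa [det_transpose]), Matrix.one_mul]
    simp only [ip, ofLp_toEuclideanCLM]
    rw [mulVec_mulVec, ← vecMul_transpose, ← dotProduct_mulVec, mulVec_mulVec, h1]
  simp [gain, h]

lemma posDef_conj_iff {M S : Matrix (Fin p) (Fin p) ℝ} (hM : IsUnit M.det) :
    (M * S * Mᵀ).PosDef ↔ S.PosDef := by
  simpa [star_eq_conjTranspose] using
    IsUnit.posDef_star_right_conjugate_iff (x := S) ((isUnit_iff_isUnit_det M).2 hM)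

lemma toEuclideanCLM_inv_apply {M : Matrix (Fin p) (Fin p) ℝ} (hM : IsUnit M.det)
    (z : EuclideanSpace ℝ (Fin p)) :
    toEuclideanCLM (𝕜 := ℝ) M (toEuclideanCLM (𝕜 := ℝ) M⁻¹ z) = z := by
  rw [← mul_apply_eq_comp, ← map_mul, mul_nonsing_inv _ hM]; simp

lemma toEuclideanCLM_apply_inv {M : Matrix (Fin p) (Fin p) ℝ} (hM : IsUnit M.det)
    (z : EuclideanSpace ℝ (Fin p)) :
    toEuclideanCLM (𝕜 := ℝ) M⁻¹ (toEuclideanCLM (𝕜 := ℝ) M z) = z := by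
  rw [← mul_apply_eq_comp, ← map_mul, nonsing_inv_mul _ hM]; simp

/-- The statistic for `K` at the transformed sample, in terms of the original sample. -/
lemma le_uitStat_act_iff (hn : 1 ≤ n) {K : Set (EuclideanSpace ℝ (Fin p))}
    (hK : IsClosedCone K) {c : ℝ} (hc : 0 < c) {M : Matrix (Fin p) (Fin p) ℝ}
    (hM : IsUnit M.det) (X : Fin n → EuclideanSpace ℝ (Fin p)) :
    c ≤ uitStat K (act M X) ↔ (sampleCov X).PosDef ∧
      ∃ z, toEuclideanCLM (𝕜 := ℝ) M z ∈ K ∧ c ≤ gain (sampleCov X) (zMean X) z := by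
  rw [le_uitStat_iff hn hK hc, sampleCov_act, zMean_act, posDef_conj_iff hM]
  refine and_congr_right fun _ => ⟨?_, ?_⟩
  · rintro ⟨z, hz, hcz⟩
    refine ⟨toEuclideanCLM (𝕜 := ℝ) M⁻¹ z, by rwa [toEuclideanCLM_inv_apply hM], ?_⟩
    rwa [← gain_conj hM, toEuclideanCLM_inv_apply hM]
  · rintro ⟨z, hz, hcz⟩
    exact ⟨_, hz, by rwa [gain_conj hM]⟩

end sample

/-! ### Coordinate functionals in the inner product of `S` -/

section coordinates

/-- `S⁻¹` maps the `i`-th column of `S` to the `i`-th basis vector, so this column represents the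
`i`-th coordinate functional. -/
lemma ip_col {S : Matrix (Fin p) (Fin p) ℝ} (hS : S.PosDef) (x : EuclideanSpace ℝ (Fin p))
    (i : Fin p) : ip S x (WithLp.toLp 2 (S.col i)) = x i := by
  have h : S⁻¹ *ᵥ (S.col i) = Pi.single i 1 := by
    rw [← mulVec_single_one, mulVec_mulVec, nonsing_inv_mul _ ((isUnit_iff_isUnit_det S).1 hS.isUnit),
      one_mulVec]
  simp [ip, h]

/-- The Cauchy-Schwarz bound for a coordinate functional. -/
lemma sq_div_le_ip {S : Matrix (Fin p) (Fin p) ℝ} (hS : S.PosDef) (x : EuclideanSpace ℝ (Fin p))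
    (i : Fin p) : x i ^ 2 / S i i ≤ ip S x x := by
  have hpos : 0 < S i i := hS.diag_pos
  set e : EuclideanSpace ℝ (Fin p) := WithLp.toLp 2 (S.col i)
  have hex : ip S e x = x i := by rw [ip_comm hS]; exact ip_col hS x i
  have h := ip_self_nonneg hS (x := x - (x i / S i i) • e)
  have h0 : (x - (x i / S i i) • e) i = 0 := by simp [e, hpos.ne']
  rw [ip_sub_right, ip_smul_right, show ip S (x - (x i / S i i) • e) e = _ from ip_col hS _ i,
    h0, ip_sub_left, ip_smul_left, hex] at h
  have h3 : x i / S i i * x i = x i ^ 2 / S i i := by ring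
  linarith

end coordinates

/-! ### Explicit form of the halfspace statistic -/

section halfSpace

/-- The last coordinate. -/
def last (p : ℕ) [NeZero p] : Fin p := ⟨p - 1, Nat.sub_one_lt (NeZero.ne p)⟩

variable [NeZero p]

lemma mem_halfSpace {θ : EuclideanSpace ℝ (Fin p)} : θ ∈ halfSpace p ↔ 0 ≤ θ (last p) := Iff.rfl

lemma isClosedCone_halfSpace : IsClosedCone (halfSpace p) where
  isClosed := isClosed_le continuous_const (by fun_prop)
  nonempty := ⟨0, by simp [mem_halfSpace]⟩
  smul_mem t ht z hz := by
    rw [mem_halfSpace] at *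
    simpa using mul_nonneg ht.le hz

/-- The statistic for the halfspace, as a function of the covariance matrix and the mean. -/
noncomputable def halfStat (S : Matrix (Fin p) (Fin p) ℝ) (x : EuclideanSpace ℝ (Fin p)) : ℝ :=
  ip S x x - min (x (last p)) 0 ^ 2 / S (last p) (last p)

/-- A point outside the halfspace is projected to the boundary hyperplane along the last column of
`S`, the normal direction for this inner product. Optimality is the Cauchy-Schwarz bound
`sq_div_le_ip` applied to `x - z`. -/
lemma isGreatest_halfStat {S : Matrix (Fin p) (Fin p) ℝ} (hS : S.PosDef)
    (x : EuclideanSpace ℝ (Fin p)) : IsGreatest (gain S x '' halfSpace p) (halfStat S x) := by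
  have hpos : 0 < S (last p) (last p) := hS.diag_pos
  refine ⟨?_, ?_⟩
  · rcases le_total 0 (x (last p)) with h | h
    · refine ⟨x, h, ?_⟩
      rw [halfStat, min_eq_right h, gain]; ring
    · set e : EuclideanSpace ℝ (Fin p) := WithLp.toLp 2 (S.col (last p)) with he
      have hel : e (last p) = S (last p) (last p) := rfl
      refine ⟨x - (x (last p) / S (last p) (last p)) • e, ?_, ?_⟩
      · rw [mem_halfSpace]
        simp [hel, hpos.ne']
      · rw [gain_eq_sqNorm_sub hS, sub_sub_cancel, sqNorm_eq_ip, sqNorm_eq_ip, ip_smul_left,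
          ip_smul_right, he, ip_col hS, ← he, hel, halfStat, min_eq_left h]
        field_simp
  · rintro _ ⟨z, hz, rfl⟩
    rw [mem_halfSpace] at hz
    rw [gain_eq_sqNorm_sub hS, halfStat, sqNorm_eq_ip, sqNorm_eq_ip]
    refine sub_le_sub_left (le_trans ?_ (sq_div_le_ip hS (x - z) (last p))) _
    gcongr ?_ / _
    rw [sq_le_sq, PiLp.sub_apply]
    rcases le_total 0 (x (last p)) with h | h
    · simp [min_eq_right h]
    · rw [min_eq_left h, abs_of_nonpos h, abs_of_nonpos (by linarith)]; linarith

lemma uitStat_halfSpace {X : Fin n → EuclideanSpace ℝ (Fin p)} (hX : (sampleCov X).PosDef) :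
    uitStat (halfSpace p) X = halfStat (sampleCov X) (zMean X) :=
  (isGreatest_uitStat hX isClosedCone_halfSpace).unique (isGreatest_halfStat hX _)

end halfSpace

/-! ### Continuity and measurability on nondegenerate samples -/

section continuity

lemma continuous_sampleMean :
    Continuous (sampleMean : (Fin n → EuclideanSpace ℝ (Fin p)) → _) := by
  unfold sampleMean; fun_prop

lemma continuous_zMean : Continuous (zMean : (Fin n → EuclideanSpace ℝ (Fin p)) → _) :=
  continuous_sampleMean.const_smul (√(n : ℝ))

lemma continuous_sampleCov :
    Continuous (sampleCov : (Fin n → EuclideanSpace ℝ (Fin p)) → _) := by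
  have := continuous_sampleMean (p := p) (n := n)
  have h : Continuous fun X : Fin n → EuclideanSpace ℝ (Fin p) =>
      ∑ k, vecMulVec (X k - sampleMean X).ofLp (X k - sampleMean X).ofLp :=
    continuous_finsetSum _ fun k _ => Continuous.matrix_vecMulVec (by fun_prop) (by fun_prop)
  exact h.const_smul ((n : ℝ) - 1)⁻¹

/-- The samples with positive definite covariance matrix. -/
def regularSet (p n : ℕ) : Set (Fin n → EuclideanSpace ℝ (Fin p)) :=
  {X | (sampleCov X).PosDef}

lemma mem_regularSet_iff (hn : 1 ≤ n) {X : Fin n → EuclideanSpace ℝ (Fin p)} :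
    X ∈ regularSet p n ↔ (sampleCov X).det ≠ 0 :=
  (sampleCov_posSemidef hn X).posDef_iff_det_ne_zero

lemma isOpen_regularSet (hn : 1 ≤ n) : IsOpen (regularSet p n) := by
  have : regularSet p n = {X | (sampleCov X).det ≠ 0} := Set.ext fun X => mem_regularSet_iff hn
  rw [this]
  exact isOpen_ne.preimage continuous_sampleCov.matrix_det

lemma continuousOn_inv_sampleCov (hn : 1 ≤ n) :
    ContinuousOn (fun X : Fin n → EuclideanSpace ℝ (Fin p) => (sampleCov X)⁻¹)
      (regularSet p n) := by
  simp only [inv_def, Ring.inverse_eq_inv']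
  refine ContinuousOn.smul (ContinuousOn.inv₀ continuous_sampleCov.matrix_det.continuousOn
    fun X hX => (mem_regularSet_iff hn).1 hX) continuous_sampleCov.matrix_adjugate.continuousOn

lemma continuousOn_ip (hn : 1 ≤ n) {Y : Type*} [TopologicalSpace Y]
    {g : Y → (Fin n → EuclideanSpace ℝ (Fin p))} {u v : Y → EuclideanSpace ℝ (Fin p)}
    (hg : Continuous g) (hu : Continuous u) (hv : Continuous v) :
    ContinuousOn (fun y => ip (sampleCov (g y)) (u y) (v y)) (g ⁻¹' regularSet p n) := by
  have hc := (continuousOn_inv_sampleCov (p := p) hn).comp (s := g ⁻¹' regularSet p n)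
    hg.continuousOn (fun _ h => h)
  have hc' := continuousOn_iff_continuous_domRestrict.1 hc
  rw [continuousOn_iff_continuous_domRestrict]
  unfold ip
  have hu' : Continuous fun y : g ⁻¹' regularSet p n => (u y).ofLp := by fun_prop
  have hv' : Continuous fun y : g ⁻¹' regularSet p n => (v y).ofLp := by fun_prop
  exact hu'.dotProduct (hc'.matrix_mulVec hv')

lemma continuousOn_uitStat_halfSpace [NeZero p] (hn : 1 ≤ n) :
    ContinuousOn (uitStat (n := n) (halfSpace p)) (regularSet p n) := by
  refine ContinuousOn.congr (f := fun X => halfStat (sampleCov X) (zMean X)) ?_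
    fun X hX => uitStat_halfSpace hX
  unfold halfStat
  refine (continuousOn_ip hn continuous_id continuous_zMean continuous_zMean).sub
    (ContinuousOn.div ?_ ?_ fun X hX => (PosDef.diag_pos hX).ne')
  · have := continuous_zMean (p := p) (n := n)
    fun_prop
  · exact (continuous_sampleCov.matrix_elem _ _).continuousOn

lemma measurableSet_regularSet (hn : 1 ≤ n) : MeasurableSet (regularSet p n) :=
  (isOpen_regularSet hn).measurableSet

lemma measurable_uitStat_halfSpace [NeZero p] (hn : 1 ≤ n) :
    Measurable (uitStat (n := n) (halfSpace p)) := by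
  classical
  have h := (continuousOn_uitStat_halfSpace (p := p) hn).measurable_piecewise
    (g := fun _ => (0 : ℝ)) continuous_const.continuousOn (measurableSet_regularSet hn)
  convert h using 1
  ext X
  by_cases hX : X ∈ regularSet p n
  · simp [hX]
  · simp [hX, uitStat_of_not_posDef hn hX]

end continuity

/-! ### Gaussian sample laws: linear images, open sets, absolute continuity -/

section law

/-- Both characteristic functions agree. The factor `D` is free, not the symmetric square root, so
it can be adapted to the cone. -/
lemma multivariateGaussian_mul_transpose (D : Matrix (Fin p) (Fin p) ℝ) :
    multivariateGaussian 0 (D * Dᵀ) =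
      (stdGaussian (EuclideanSpace ℝ (Fin p))).map (toEuclideanCLM (𝕜 := ℝ) D) := by
  have hps : (D * Dᵀ).PosSemidef := by
    simpa using posSemidef_self_mul_conjTranspose D
  apply Measure.ext_of_charFun
  ext t
  have hadj : ∀ x, inner ℝ (toEuclideanCLM (𝕜 := ℝ) D x) t =
      inner ℝ x (toEuclideanCLM (𝕜 := ℝ) Dᵀ t) := fun x => by
    simp only [EuclideanSpace.inner_eq_star_dotProduct, ofLp_toEuclideanCLM, star_trivial]
    rw [dotProduct_mulVec, ← mulVec_transpose]
  rw [charFun_multivariateGaussian hps, charFun_apply,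
    integral_map (by fun_prop) (Measurable.aestronglyMeasurable (by fun_prop))]
  simp_rw [hadj]
  rw [← charFun_apply, charFun_stdGaussian]
  congr 1
  have : ‖toEuclideanCLM (𝕜 := ℝ) Dᵀ t‖ ^ 2 = t.ofLp ⬝ᵥ (D * Dᵀ) *ᵥ t.ofLp := by
    rw [EuclideanSpace.real_norm_sq_eq, ← mulVec_mulVec, dotProduct_mulVec, ← mulVec_transpose]
    simp [dotProduct, sq, ofLp_toEuclideanCLM]
  rw [← Complex.ofReal_pow, this]
  simp [neg_div]

lemma measurable_act (D : Matrix (Fin p) (Fin p) ℝ) : Measurable (act (n := n) D) := by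
  unfold act; fun_prop

/-- The linear action of an invertible matrix, as a measurable equivalence. -/
noncomputable def actEquiv {D : Matrix (Fin p) (Fin p) ℝ} (hD : IsUnit D.det) :
    (Fin n → EuclideanSpace ℝ (Fin p)) ≃ᵐ (Fin n → EuclideanSpace ℝ (Fin p)) where
  toFun := act D
  invFun := act D⁻¹
  left_inv X := by ext1 k; exact toEuclideanCLM_apply_inv hD (X k)
  right_inv X := by ext1 k; exact toEuclideanCLM_inv_apply hD (X k)
  measurable_toFun := measurable_act D
  measurable_invFun := measurable_act D⁻¹

instance (θ : EuclideanSpace ℝ (Fin p)) (Sg : Matrix (Fin p) (Fin p) ℝ) :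
    IsProbabilityMeasure (sampleLaw n θ Sg) := by
  unfold sampleLaw; infer_instance

lemma sampleLaw_zero_one :
    sampleLaw n (0 : EuclideanSpace ℝ (Fin p)) 1 = Measure.pi fun _ => stdGaussian _ := by
  simp [sampleLaw]

lemma sampleLaw_mul_transpose (D : Matrix (Fin p) (Fin p) ℝ) :
    sampleLaw n 0 (D * Dᵀ) = (sampleLaw n 0 1).map (act D) := by
  rw [sampleLaw_zero_one, sampleLaw, multivariateGaussian_mul_transpose]
  exact (Measure.pi_map_pi (fun _ => by fun_prop)).symm

lemma power_mul_transpose {D : Matrix (Fin p) (Fin p) ℝ} (hD : IsUnit D.det)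
    (K : Set (EuclideanSpace ℝ (Fin p))) (c : ℝ) :
    power n K c 0 (D * Dᵀ) = (sampleLaw n 0 1).real {X | c ≤ uitStat K (act D X)} := by
  rw [power, sampleLaw_mul_transpose, measureReal_def, measureReal_def]
  congr 1
  exact (actEquiv hD).map_apply _

instance isOpenPosMeasure_stdGaussian :
    (stdGaussian (EuclideanSpace ℝ (Fin p))).IsOpenPosMeasure := by
  have : (gaussianReal 0 1).IsOpenPosMeasure :=
    (gaussianReal_absolutelyContinuous' 0 one_ne_zero).isOpenPosMeasure
  rw [← map_pi_eq_stdGaussian]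
  exact Continuous.isOpenPosMeasure_map (by fun_prop) (WithLp.toLp_surjective 2)

-- This turns nonempty open sets of samples into strict inequalities between rejection
-- probabilities.
open scoped MatrixOrder in
instance isOpenPosMeasure_sampleLaw_one (θ : EuclideanSpace ℝ (Fin p)) :
    (sampleLaw n θ 1).IsOpenPosMeasure := by
  have h : (multivariateGaussian θ (1 : Matrix (Fin p) (Fin p) ℝ)).IsOpenPosMeasure := by
    rw [multivariateGaussian, CFC.sqrt_one, map_one]
    exact Continuous.isOpenPosMeasure_map (by fun_prop)
      fun y => ⟨y - θ, by simp⟩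
  have : ∀ _ : Fin n, (multivariateGaussian θ (1 : Matrix (Fin p) (Fin p) ℝ)).IsOpenPosMeasure :=
    fun _ => h
  exact Measure.pi.isOpenPosMeasure (μ := fun _ : Fin n => multivariateGaussian θ 1)

lemma pi_absolutelyContinuous {α : Type*} [MeasurableSpace α] {μ ν : Measure α} [SigmaFinite μ]
    [SigmaFinite ν] (h : μ ≪ ν) (n : ℕ) :
    (Measure.pi fun _ : Fin n => μ) ≪ Measure.pi fun _ : Fin n => ν := by
  induction n with
  | zero => rw [Measure.pi_of_empty, Measure.pi_of_empty]
  | succ k ih =>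
    have h1 := (measurePreserving_piFinSuccAbove (fun _ : Fin (k + 1) => μ) 0).symm
    have h2 := (measurePreserving_piFinSuccAbove (fun _ : Fin (k + 1) => ν) 0).symm
    rw [← h1.map_eq, ← h2.map_eq]
    exact (h.prod ih).map (MeasurableEquiv.measurable _)

lemma stdGaussian_absolutelyContinuous :
    stdGaussian (EuclideanSpace ℝ (Fin p)) ≪ volume := by
  rw [← map_pi_eq_stdGaussian, ← (PiLp.volume_preserving_toLp (Fin p)).map_eq]
  exact (pi_absolutelyContinuous (gaussianReal_absolutelyContinuous 0 one_ne_zero) p).map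
    (by fun_prop)

lemma sampleLaw_absolutelyContinuous :
    sampleLaw n (0 : EuclideanSpace ℝ (Fin p)) 1 ≪ volume := by
  rw [sampleLaw_zero_one]
  exact pi_absolutelyContinuous stdGaussian_absolutelyContinuous n

end law

/-! ### The null law for the halfspace does not depend on `Σ` -/

section factor

/-- A symmetric orthogonal matrix that maps a given vector to a multiple of a coordinate
vector. -/
lemma exists_reflection (i : Fin p) (u : Fin p → ℝ) :
    ∃ Q : Matrix (Fin p) (Fin p) ℝ, Qᵀ = Q ∧ Q * Q = 1 ∧
      Q *ᵥ u = √(u ⬝ᵥ u) • Pi.single i 1 := by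
  have h0 : 0 ≤ u ⬝ᵥ u := by simpa using dotProduct_star_self_nonneg u
  set r := √(u ⬝ᵥ u) with hr
  have hrr : r * r = u ⬝ᵥ u := Real.mul_self_sqrt h0
  -- Householder reflection in the hyperplane orthogonal to `w`; it exchanges `u` with a vector of
  -- the same length.
  set w := u - r • Pi.single i (1 : ℝ) with hw
  by_cases hw0 : w = 0
  · exact ⟨1, by simp, by simp, by simpa using sub_eq_zero.1 (hw ▸ hw0)⟩
  have hww : w ⬝ᵥ w ≠ 0 := by simpa [dotProduct_self_eq_zero] using hw0
  have hwu : w ⬝ᵥ w = 2 * (w ⬝ᵥ u) := by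
    simp only [hw, sub_dotProduct, dotProduct_sub, smul_dotProduct, dotProduct_smul,
      single_one_dotProduct, dotProduct_single_one, Pi.single_eq_same, smul_eq_mul, ← hrr,
      Pi.sub_apply, Pi.smul_apply]
    ring
  refine ⟨1 - (2 / (w ⬝ᵥ w)) • vecMulVec w w, ?_, ?_, ?_⟩
  · simp [transpose_vecMulVec]
  · have : vecMulVec w w * vecMulVec w w = (w ⬝ᵥ w) • vecMulVec w w := by
      rw [vecMulVec_mul_vecMulVec]
      ext a b; simp [vecMulVec_apply]; ring
    rw [sub_mul, mul_sub, mul_sub, Matrix.one_mul, Matrix.mul_one, Matrix.one_mul, smul_mul_smul,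
      this, smul_smul]
    have h2 : 2 / (w ⬝ᵥ w) * (2 / (w ⬝ᵥ w)) * (w ⬝ᵥ w) = 2 / (w ⬝ᵥ w) + 2 / (w ⬝ᵥ w) := by
      field_simp; norm_num
    rw [h2, add_smul]; abel
  · rw [sub_mulVec, one_mulVec, smul_mulVec, vecMulVec_mulVec]
    have h2 : 2 / (w ⬝ᵥ w) * (w ⬝ᵥ u) = 1 := by
      rw [hwu, div_mul_eq_mul_div, div_self (hwu ▸ hww)]
    ext j
    have := congrFun hw j
    simp only [Pi.sub_apply, Pi.smul_apply, smul_eq_mul, MulOpposite.smul_eq_mul_unop,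
      MulOpposite.unop_op] at this ⊢
    have h3 : 2 / (w ⬝ᵥ w) * (w j * (w ⬝ᵥ u)) = w j := by
      rw [mul_left_comm, h2, mul_one]
    rw [h3, this]; ring

open scoped MatrixOrder in
/-- Every positive definite matrix is `D D'` for a matrix `D` which multiplies the last
coordinate of vectors by a positive number. -/
lemma exists_factor [NeZero p] {Sg : Matrix (Fin p) (Fin p) ℝ} (hS : Sg.PosDef) :
    ∃ D : Matrix (Fin p) (Fin p) ℝ, ∃ b : ℝ, 0 < b ∧ IsUnit D.det ∧ D * Dᵀ = Sg ∧
      ∀ x : EuclideanSpace ℝ (Fin p), toEuclideanCLM (𝕜 := ℝ) D x (last p) = b * x (last p) := by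
  obtain ⟨B, hB⟩ := CStarAlgebra.nonneg_iff_eq_star_mul_self.mp hS.posSemidef.nonneg
  rw [star_eq_conjTranspose, conjTranspose_eq_transpose_of_trivial] at hB
  have hdet : B.det ≠ 0 := fun h => by
    have h2 := hS.det_pos
    rw [hB, det_mul, h, mul_zero] at h2
    exact h2.false
  have hBu : IsUnit B.det := isUnit_iff_ne_zero.2 hdet
  set u : Fin p → ℝ := B *ᵥ Pi.single (last p) 1 with hu
  have hu0 : u ≠ 0 := fun h => by
    have h1 : B⁻¹ *ᵥ u = Pi.single (last p) 1 := by
      rw [hu, mulVec_mulVec, nonsing_inv_mul _ hBu, one_mulVec]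
    rw [h, mulVec_zero] at h1
    simpa using congrFun h1 (last p)
  have hpos : 0 < u ⬝ᵥ u := by
    simpa using dotProduct_star_self_pos_iff.2 hu0
  -- With `Σ = B' B`, the last row of `B' Q` is `(Q u)'`, a positive multiple of the last coordinate
  -- vector.
  obtain ⟨Q, hQt, hQQ, hQu⟩ := exists_reflection (last p) u
  have hDD : Bᵀ * Q * (Bᵀ * Q)ᵀ = Sg := by
    rw [transpose_mul, transpose_transpose, hQt, Matrix.mul_assoc, ← Matrix.mul_assoc Q, hQQ,
      Matrix.one_mul, hB]
  refine ⟨Bᵀ * Q, √(u ⬝ᵥ u), Real.sqrt_pos.2 hpos, ?_, hDD, fun x => ?_⟩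
  · refine isUnit_iff_ne_zero.2 fun h => ?_
    have h2 := hS.det_pos
    rw [← hDD, det_mul, h, zero_mul] at h2
    exact h2.false
  · have h1 : ((Bᵀ * Q) *ᵥ x.ofLp) (last p) =
        Pi.single (last p) (1 : ℝ) ⬝ᵥ ((Bᵀ * Q) *ᵥ x.ofLp) := by simp
    rw [ofLp_toEuclideanCLM, h1, dotProduct_mulVec, ← mulVec_transpose, transpose_mul,
      transpose_transpose, hQt, ← mulVec_mulVec, ← hu, hQu]
    simp

/-- The null distribution of the statistic for the halfspace does not depend on `Σ`. -/
lemma power_halfSpace_zero [NeZero p] (hn : 1 ≤ n) {c : ℝ} (hc : 0 < c)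
    {Sg : Matrix (Fin p) (Fin p) ℝ} (hS : Sg.PosDef) :
    power n (halfSpace p) c 0 Sg =
      (sampleLaw n 0 1).real {X | c ≤ uitStat (halfSpace p) X} := by
  obtain ⟨D, b, hb, hD, rfl, hlast⟩ := exists_factor hS
  rw [power_mul_transpose hD]
  congr 1
  ext X
  simp only [Set.mem_ofPred_eq]
  rw [le_uitStat_act_iff hn isClosedCone_halfSpace hc hD,
    le_uitStat_iff hn isClosedCone_halfSpace hc]
  simp only [mem_halfSpace, hlast, mul_nonneg_iff_of_pos_left hb]

end factor

/-! ### Null sets of samples -/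

section nullSets

/-- A set is null if almost all members of a one-parameter family of transformations reflect
nullness and every orbit meets the set in a null set of parameters. -/
lemma null_of_family {E : Type*} [MeasurableSpace E] {μ : Measure E} [SFinite μ] {Z : Set E}
    (hZ : MeasurableSet Z) (Φ : ℝ → E → E) (hΦ : Measurable fun q : E × ℝ => Φ q.2 q.1)
    (hpre : ∀ t ∈ Set.Ioo (1 : ℝ) 2, μ (Φ t ⁻¹' Z) = 0 → μ Z = 0)
    (horb : ∀ X, volume {t ∈ Set.Ioo (1 : ℝ) 2 | Φ t X ∈ Z} = 0) : μ Z = 0 := by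
  set ν : Measure ℝ := volume.restrict (Set.Ioo 1 2) with hν
  have hs : MeasurableSet {q : E × ℝ | Φ q.2 q.1 ∈ Z} := hΦ hZ
  -- Fubini in both orders: null slices in `t` give a null set in the product, hence a null preimage
  -- for almost every `t`.
  have h1 : (μ.prod ν) {q : E × ℝ | Φ q.2 q.1 ∈ Z} = 0 := by
    rw [Measure.measure_prod_null hs]
    refine Filter.Eventually.of_forall fun X => ?_
    have hm : MeasurableSet {t | Φ t X ∈ Z} := measurable_prodMk_left hs
    have h2 : ν {t | Φ t X ∈ Z} = volume {t ∈ Set.Ioo (1 : ℝ) 2 | Φ t X ∈ Z} := by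
      rw [hν, Measure.restrict_apply hm, Set.inter_comm]; rfl
    exact h2.trans (horb X)
  have h2 : ∀ᵐ t ∂ν, μ (Φ t ⁻¹' Z) = 0 := by
    rw [← Measure.prod_swap, Measure.map_apply measurable_swap hs] at h1
    exact Measure.measure_ae_null_of_prod_null h1
  have h3 : ∀ᵐ t ∂ν, t ∈ Set.Ioo (1 : ℝ) 2 := ae_restrict_mem measurableSet_Ioo
  have : NeZero ν := ⟨by rw [hν, Ne, Measure.restrict_eq_zero]; norm_num⟩
  obtain ⟨t, ht, ht'⟩ := (h2.and h3).exists
  exact hpre t ht' ht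

lemma sampleMean_add_const (hn : 1 ≤ n) (X : Fin n → EuclideanSpace ℝ (Fin p))
    (v : EuclideanSpace ℝ (Fin p)) : sampleMean (X + fun _ => v) = sampleMean X + v := by
  have : (n : ℝ) ≠ 0 := by positivity
  simp only [sampleMean, Pi.add_apply, Finset.sum_add_distrib, smul_add, Finset.sum_const,
    Finset.card_univ, Fintype.card_fin]
  rw [← Nat.cast_smul_eq_nsmul ℝ, smul_smul, inv_mul_cancel₀ this, one_smul]

lemma zMean_add_const (hn : 1 ≤ n) (X : Fin n → EuclideanSpace ℝ (Fin p))
    (v : EuclideanSpace ℝ (Fin p)) : zMean (X + fun _ => v) = zMean X + √(n : ℝ) • v := by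
  simp [zMean, sampleMean_add_const hn]

lemma sampleCov_add_const (hn : 1 ≤ n) (X : Fin n → EuclideanSpace ℝ (Fin p))
    (v : EuclideanSpace ℝ (Fin p)) : sampleCov (X + fun _ => v) = sampleCov X := by
  simp [sampleCov, sampleMean_add_const hn]

lemma exists_zMean_eq (hn : 1 ≤ n) (X : Fin n → EuclideanSpace ℝ (Fin p))
    (m : EuclideanSpace ℝ (Fin p)) : ∃ Y : Fin n → EuclideanSpace ℝ (Fin p),
      sampleCov Y = sampleCov X ∧ zMean Y = m := by
  have : √(n : ℝ) ≠ 0 := by positivity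
  refine ⟨_, sampleCov_add_const hn X ((√(n : ℝ))⁻¹ • (m - zMean X)), ?_⟩
  rw [zMean_add_const hn, smul_smul, mul_inv_cancel₀ this, one_smul, add_sub_cancel]

/-- The `p` basis vectors padded with zeros are affinely independent up to repetition. A vector `v`
in the kernel of the covariance has equal products with all observations; one observation is `0`, so
all coordinates of `v` vanish. -/
lemma nonempty_regularSet (hn : p < n) : (regularSet p n).Nonempty := by
  classical
  let X : Fin n → EuclideanSpace ℝ (Fin p) := fun k =>
    if h : (k : ℕ) < p then EuclideanSpace.single ⟨k, h⟩ 1 else 0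
  have hn1 : 1 ≤ n := by omega
  have hps := sampleCov_posSemidef hn1 X
  refine ⟨X, PosDef.of_dotProduct_mulVec_pos hps.isHermitian fun v hv => ?_⟩
  refine lt_of_le_of_ne (hps.dotProduct_mulVec_nonneg v) fun h0 => hv ?_
  have hn' : 1 < (n : ℝ) ∨ p = 0 := by
    rcases Nat.eq_zero_or_pos p with h | h
    · exact Or.inr h
    · exact Or.inl (by exact_mod_cast (by omega : 1 < n))
  rcases hn' with hn' | rfl
  · have hsum : ∑ k, (v ⬝ᵥ (X k - sampleMean X).ofLp) ^ 2 = 0 := by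
      have hne : ((n : ℝ) - 1)⁻¹ ≠ 0 := by
        apply inv_ne_zero; linarith
      rw [sampleCov, smul_mulVec, dotProduct_smul, smul_eq_mul, eq_comm, mul_eq_zero,
        or_iff_right hne, sum_mulVec, dotProduct_sum] at h0
      rw [← h0]
      refine Finset.sum_congr rfl fun k _ => ?_
      rw [vecMulVec_mulVec, dotProduct_smul, star_trivial, dotProduct_comm _ v]
      simp [sq]
    have hk : ∀ k, v ⬝ᵥ (X k).ofLp = v ⬝ᵥ (sampleMean X).ofLp := fun k => by
      have := (Finset.sum_eq_zero_iff_of_nonneg (fun k _ => sq_nonneg _)).1 hsum k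
        (Finset.mem_univ k)
      rwa [sq_eq_zero_iff, WithLp.ofLp_sub, dotProduct_sub, sub_eq_zero] at this
    have hlast : v ⬝ᵥ (sampleMean X).ofLp = 0 := by
      rw [← hk ⟨p, hn⟩]; simp [X]
    ext i
    have := hk ⟨i, i.2.trans hn⟩
    rw [hlast] at this
    simpa [X] using this
  · exact Subsingleton.elim _ _

/-- The mixed sample covariance matrix of two samples. -/
noncomputable def crossCov (X Y : Fin n → EuclideanSpace ℝ (Fin p)) :
    Matrix (Fin p) (Fin p) ℝ :=
  ((n : ℝ) - 1)⁻¹ • ∑ k, vecMulVec (X k - sampleMean X).ofLp (Y k - sampleMean Y).ofLp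

lemma sampleCov_add_smul (X Y : Fin n → EuclideanSpace ℝ (Fin p)) (t : ℝ) :
    sampleCov (X + t • Y) =
      sampleCov X + t • (crossCov X Y + crossCov Y X) + t ^ 2 • sampleCov Y := by
  have hm : sampleMean (X + t • Y) = sampleMean X + t • sampleMean Y := by
    simp only [sampleMean, Pi.add_apply, Pi.smul_apply, Finset.sum_add_distrib, smul_add,
      ← Finset.smul_sum]
    rw [smul_comm]
  ext i j
  simp only [sampleCov, crossCov, hm, Matrix.smul_apply, Matrix.add_apply, Matrix.sum_apply,
    vecMulVec_apply, smul_eq_mul, Finset.mul_sum, ← Finset.sum_add_distrib]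
  refine Finset.sum_congr rfl fun k _ => ?_
  simp
  ring

/-- The determinant is a polynomial in `t` that is nonzero at `t = 0`. -/
lemma finite_setOf_det_eq_zero {A B C : Matrix (Fin p) (Fin p) ℝ} (hA : A.det ≠ 0) :
    {t : ℝ | (A + t • B + t ^ 2 • C).det = 0}.Finite := by
  let P : Matrix (Fin p) (Fin p) (Polynomial ℝ) :=
    A.map Polynomial.C + (Polynomial.X : Polynomial ℝ) • B.map Polynomial.C +
      (Polynomial.X ^ 2 : Polynomial ℝ) • C.map Polynomial.C
  have hP : ∀ t : ℝ, P.det.eval t = (A + t • B + t ^ 2 • C).det := fun t => by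
    have h := RingHom.map_det (Polynomial.evalRingHom t) P
    rw [Polynomial.coe_evalRingHom] at h
    rw [h]
    congr 1
    ext i j
    simp [P]; ring
  have h0 : P.det ≠ 0 := fun h => hA (by simpa [h] using (hP 0).symm)
  refine (P.det.roots.toFinset.finite_toSet).subset fun t ht => ?_
  simp only [Finset.mem_coe, Multiset.mem_toFinset]
  rw [Polynomial.mem_roots h0, Polynomial.IsRoot, hP]
  exact ht

/-- Each line through a fixed nondegenerate sample contains only finitely many degenerate ones. -/
lemma volume_compl_regularSet (hn : p < n) : volume (regularSet p n)ᶜ = 0 := by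
  obtain ⟨X₀, hX₀⟩ := nonempty_regularSet hn
  have hn1 : 1 ≤ n := by omega
  refine null_of_family (measurableSet_regularSet hn1).compl (fun t X => X₀ + t • X)
    (by fun_prop) (fun t ht h => ?_) fun X => ?_
  · have ht0 : t ≠ 0 := by linarith [ht.1]
    have h1 : (fun X => X₀ + t • X) ⁻¹' (regularSet p n)ᶜ =
      (t • ·) ⁻¹' ((X₀ + ·) ⁻¹' (regularSet p n)ᶜ) := rfl
    rw [h1, Measure.addHaar_preimage_smul _ ht0, measure_preimage_add] at h
    refine (mul_eq_zero.1 h).resolve_left ?_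
    simp [ht0]
  · refine Set.Finite.measure_zero ((finite_setOf_det_eq_zero
      ((mem_regularSet_iff hn1).1 hX₀) (B := crossCov X₀ X + crossCov X X₀)
      (C := sampleCov X)).subset ?_) _
    rintro t ⟨-, ht⟩
    rw [Set.mem_compl_iff, mem_regularSet_iff hn1, not_not, sampleCov_add_smul] at ht
    exact ht

/-- The transformation of samples that multiplies the mean by `t` and keeps the residuals. -/
noncomputable def scaleMean (t : ℝ) (X : Fin n → EuclideanSpace ℝ (Fin p)) :
    Fin n → EuclideanSpace ℝ (Fin p) :=
  X + fun _ => (t - 1) • sampleMean X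

lemma sampleMean_scaleMean (hn : 1 ≤ n) (t : ℝ) (X : Fin n → EuclideanSpace ℝ (Fin p)) :
    sampleMean (scaleMean t X) = t • sampleMean X := by
  rw [scaleMean, sampleMean_add_const hn, sub_smul, one_smul, add_sub_cancel]

lemma zMean_scaleMean (hn : 1 ≤ n) (t : ℝ) (X : Fin n → EuclideanSpace ℝ (Fin p)) :
    zMean (scaleMean t X) = t • zMean X := by
  rw [zMean, sampleMean_scaleMean hn, smul_comm, zMean]

lemma sampleCov_scaleMean (hn : 1 ≤ n) (t : ℝ) (X : Fin n → EuclideanSpace ℝ (Fin p)) :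
    sampleCov (scaleMean t X) = sampleCov X :=
  sampleCov_add_const hn _ _

lemma scaleMean_scaleMean (hn : 1 ≤ n) {t s : ℝ} (h : t * s = 1)
    (X : Fin n → EuclideanSpace ℝ (Fin p)) : scaleMean t (scaleMean s X) = X := by
  conv_lhs => rw [scaleMean, sampleMean_scaleMean hn, scaleMean]
  ext1 k
  simp only [Pi.add_apply, smul_smul, add_assoc, ← add_smul]
  rw [show s - 1 + (t - 1) * s = 0 by linear_combination h]
  simp

lemma volume_eq_zero_of_scaleMean (hn : 1 ≤ n) {t : ℝ} (ht : t ≠ 0)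
    {Z : Set (Fin n → EuclideanSpace ℝ (Fin p))} (h : volume (scaleMean t ⁻¹' Z) = 0) :
    volume Z = 0 := by
  let f : (Fin n → EuclideanSpace ℝ (Fin p)) ≃ₗ[ℝ] (Fin n → EuclideanSpace ℝ (Fin p)) :=
    { toFun := scaleMean t
      invFun := scaleMean t⁻¹
      map_add' := fun X Y => by
        ext1 k
        simp only [scaleMean, sampleMean, Pi.add_apply, Finset.sum_add_distrib, smul_add]
        abel
      map_smul' := fun a X => by
        ext1 k
        simp only [scaleMean, sampleMean, Pi.add_apply, Pi.smul_apply, ← Finset.smul_sum,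
          smul_add, RingHom.id_apply]
        rw [smul_comm a, smul_comm a]
      left_inv := scaleMean_scaleMean hn (inv_mul_cancel₀ ht)
      right_inv := scaleMean_scaleMean hn (mul_inv_cancel₀ ht) }
  have hf : LinearMap.det f.toLinearMap ≠ 0 := f.isUnit_det'.ne_zero
  have h2 := Measure.addHaar_preimage_linearMap volume hf Z
  rw [show (f.toLinearMap : _ → _) ⁻¹' Z = scaleMean t ⁻¹' Z from rfl, h] at h2
  refine (mul_eq_zero.1 h2.symm).resolve_left ?_
  simp [hf]

lemma halfStat_smul [NeZero p] (S : Matrix (Fin p) (Fin p) ℝ) (x : EuclideanSpace ℝ (Fin p))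
    {t : ℝ} (ht : 0 ≤ t) : halfStat S (t • x) = t ^ 2 * halfStat S x := by
  have : min (t * x (last p)) 0 = t * min (x (last p)) 0 := by
    rw [mul_min_of_nonneg _ _ ht, mul_zero]
  simp only [halfStat, ip_smul_left, ip_smul_right, PiLp.smul_apply, smul_eq_mul, this]
  ring

lemma uitStat_halfSpace_scaleMean [NeZero p] (hn : 1 ≤ n) {t : ℝ} (ht : 0 ≤ t)
    (X : Fin n → EuclideanSpace ℝ (Fin p)) :
    uitStat (halfSpace p) (scaleMean t X) = t ^ 2 * uitStat (halfSpace p) X := by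
  by_cases h : (sampleCov X).PosDef
  · rw [uitStat_halfSpace h, uitStat_halfSpace (by rwa [sampleCov_scaleMean hn]),
      sampleCov_scaleMean hn, zMean_scaleMean hn, halfStat_smul _ _ ht]
  · rw [uitStat_of_not_posDef hn h,
      uitStat_of_not_posDef hn (by rwa [sampleCov_scaleMean hn]), mul_zero]

/-- Scaling the mean by `t` multiplies the statistic by `t²`, so each orbit takes the value `c > 0`
for at most one `t`. -/
lemma volume_uitStat_halfSpace_eq [NeZero p] (hn : 1 ≤ n) {c : ℝ} (hc : 0 < c) :
    volume {X : Fin n → EuclideanSpace ℝ (Fin p) | uitStat (halfSpace p) X = c} = 0 := by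
  refine null_of_family (measurable_uitStat_halfSpace hn (measurableSet_singleton c)) scaleMean
    ?_ (fun t ht => volume_eq_zero_of_scaleMean hn (by linarith [ht.1])) fun X => ?_
  · have : Continuous fun q : (Fin n → EuclideanSpace ℝ (Fin p)) × ℝ => scaleMean q.2 q.1 := by
      have := continuous_sampleMean (p := p) (n := n)
      unfold scaleMean
      fun_prop
    exact this.measurable
  · refine Set.Subsingleton.measure_zero ?_ _
    rintro t ⟨ht, htc⟩ s ⟨hs, hsc⟩
    have ht0 : 0 ≤ t := by linarith [ht.1]
    have hs0 : 0 ≤ s := by linarith [hs.1]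
    have h1 : t ^ 2 * uitStat (halfSpace p) X = c := by
      rw [← uitStat_halfSpace_scaleMean hn ht0]; exact htc
    have h2 : s ^ 2 * uitStat (halfSpace p) X = c := by
      rw [← uitStat_halfSpace_scaleMean hn hs0]; exact hsc
    have h3 : uitStat (halfSpace p) X ≠ 0 := fun h => by
      rw [h, mul_zero] at h1; exact hc.ne h1
    exact (pow_left_inj₀ ht0 hs0 two_ne_zero).1 (mul_right_cancel₀ h3 (h1.trans h2.symm))

/-- Translating the sample along the `i`-th basis vector changes this product affinely, with
positive slope. -/
lemma volume_ip_single_eq_zero (hn : 1 ≤ n) (i : Fin p) :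
    volume {X ∈ regularSet p n |
      ip (sampleCov X) (EuclideanSpace.single i 1) (zMean X) = 0} = 0 := by
  set Z := {X ∈ regularSet p n |
      ip (sampleCov X) (EuclideanSpace.single i 1) (zMean X) = 0} with hZdef
  have hZ : Z = regularSet p n ∩ {X | ((sampleCov X).adjugate *ᵥ (zMean X).ofLp) i = 0} := by
    ext X
    refine and_congr_right fun hX => ?_
    have := (mem_regularSet_iff hn).1 hX
    simp [ip, inv_def, smul_mulVec, this]
  have hZm : MeasurableSet Z := by
    rw [hZ]
    refine (measurableSet_regularSet hn).inter (IsClosed.measurableSet ?_)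
    refine isClosed_eq ?_ continuous_const
    have h1 := (continuous_sampleCov (p := p) (n := n)).matrix_adjugate
    have h2 := continuous_zMean (p := p) (n := n)
    exact (continuous_apply i).comp (h1.matrix_mulVec (by fun_prop))
  refine null_of_family hZm
    (fun t X => X + fun _ => t • EuclideanSpace.single i 1) (by fun_prop) (fun t ht h => ?_)
    fun X => ?_
  · rwa [show (fun X : Fin n → EuclideanSpace ℝ (Fin p) =>
      X + fun _ => t • EuclideanSpace.single i 1) ⁻¹' Z =
      (· + fun _ => t • EuclideanSpace.single i 1) ⁻¹' Z from rfl,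
      measure_preimage_add_right] at h
  · refine Set.Subsingleton.measure_zero ?_ _
    rintro t ⟨-, ht, ht'⟩ s ⟨-, hs, hs'⟩
    rw [regularSet, Set.mem_ofPred_eq, sampleCov_add_const hn] at ht
    rw [sampleCov_add_const hn, zMean_add_const hn, ip_add_right, smul_smul,
      ip_smul_right] at ht' hs'
    have hpos : 0 < ip (sampleCov X) (EuclideanSpace.single i 1) (EuclideanSpace.single i 1) :=
      ip_self_pos ht (by simp)
    have hn' : √(n : ℝ) ≠ 0 := by positivity
    have h1 := ht'.trans hs'.symm
    rw [add_right_inj] at h1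
    exact mul_left_cancel₀ hn' (mul_right_cancel₀ hpos.ne' h1)

/-- The best multiple of a basis vector already has positive gain. It may have either sign when the
vector lies in the boundary hyperplane, and must be positive for the last one. -/
lemma uitStat_halfSpace_pos [NeZero p] {X : Fin n → EuclideanSpace ℝ (Fin p)}
    (hX : X ∈ regularSet p n) {i : Fin p}
    (hi : 0 < ip (sampleCov X) (EuclideanSpace.single i 1) (zMean X) ∨
      i ≠ last p ∧ ip (sampleCov X) (EuclideanSpace.single i 1) (zMean X) ≠ 0) :
    0 < uitStat (halfSpace p) X := by
  set e : EuclideanSpace ℝ (Fin p) := EuclideanSpace.single i 1 with he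
  have ha : 0 < ip (sampleCov X) e e := ip_self_pos hX (by simp [he])
  set y := ip (sampleCov X) e (zMean X) with hy
  have hmem : (y / ip (sampleCov X) e e) • e ∈ halfSpace p := by
    rw [mem_halfSpace]
    rcases hi with h | ⟨h, -⟩
    · have : 0 ≤ e (last p) := by
        simp only [he, EuclideanSpace.single, PiLp.single_apply]; split_ifs <;> norm_num
      simpa using mul_nonneg (div_pos h ha).le this
    · simp [he, h.symm]
  have hy0 : y ≠ 0 := by rcases hi with h | ⟨-, h⟩; exacts [h.ne', h]
  refine lt_of_lt_of_le ?_ ((isGreatest_uitStat hX isClosedCone_halfSpace).2 ⟨_, hmem, rfl⟩)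
  have : gain (sampleCov X) (zMean X) ((y / ip (sampleCov X) e e) • e) =
      y ^ 2 / ip (sampleCov X) e e := by
    rw [gain, ip_smul_right, ip_smul_left, ip_smul_right, ip_comm hX (x := zMean X),
      ← hy]
    field_simp; ring
  rw [this]
  positivity

end nullSets

/-! ### Mass of the statistic at zero under the null law -/

section nullLaw

local notation "G" => sampleLaw n (0 : EuclideanSpace ℝ (Fin p)) 1

lemma ae_mem_regularSet (hn : p < n) : ∀ᵐ X ∂G, X ∈ regularSet p n :=
  sampleLaw_absolutelyContinuous (volume_compl_regularSet hn)

lemma ae_ip_single_ne_zero (hn : p < n) (i : Fin p) :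
    ∀ᵐ X ∂G, X ∈ regularSet p n ∧
      ip (sampleCov X) (EuclideanSpace.single i 1) (zMean X) ≠ 0 := by
  have h : ∀ᵐ X ∂G, X ∉ {X ∈ regularSet p n |
      ip (sampleCov X) (EuclideanSpace.single i 1) (zMean X) = 0} :=
    measure_eq_zero_iff_ae_notMem.1
      (sampleLaw_absolutelyContinuous (volume_ip_single_eq_zero (by omega) i))
  filter_upwards [ae_mem_regularSet hn, h] with X h1 h2
  exact ⟨h1, fun h3 => h2 ⟨h1, h3⟩⟩

lemma ae_uitStat_halfSpace_pos [NeZero p] (hn : p < n) (hp : p ≠ 1) :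
    ∀ᵐ X ∂G, 0 < uitStat (halfSpace p) X := by
  have hp0 := NeZero.ne p
  filter_upwards [ae_ip_single_ne_zero hn ⟨0, by omega⟩] with X hX
  refine uitStat_halfSpace_pos hX.1 (Or.inr ⟨?_, hX.2⟩)
  rw [last, Ne, Fin.mk.injEq]
  omega

/-- The null law is invariant under `X ↦ -X`, and almost surely the statistic is positive at `X` or
at `-X`. This is the source of the restriction `α < 1/2` for `p = 1`. -/
lemma measure_uitStat_halfSpace_nonpos_le [NeZero p] (hn : p < n) :
    (G).real {X | uitStat (halfSpace p) X ≤ 0} ≤ 1 / 2 := by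
  have hn1 : 1 ≤ n := by omega
  have hm : MeasurableSet {X : Fin n → EuclideanSpace ℝ (Fin p) | uitStat (halfSpace p) X ≤ 0} :=
    measurable_uitStat_halfSpace hn1 measurableSet_Iic
  set N := {X : Fin n → EuclideanSpace ℝ (Fin p) | uitStat (halfSpace p) X ≤ 0}
  have hG : (G).map (act (-1)) = G := by
    rw [← sampleLaw_mul_transpose]; simp
  have hN : (G).real (act (-1) ⁻¹' N) = (G).real N := by
    conv_rhs => rw [← hG]
    rw [measureReal_def, measureReal_def, Measure.map_apply (measurable_act _) hm]
  have hdisj : (G).real (N ∩ act (-1) ⁻¹' N) = 0 := by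
    rw [measureReal_eq_zero_iff, measure_eq_zero_iff_ae_notMem]
    filter_upwards [ae_ip_single_ne_zero hn (last p)] with X hX hmem
    rcases lt_or_gt_of_ne hX.2 with h | h
    · have hc : sampleCov (act (-1) X) = sampleCov X := by rw [sampleCov_act]; simp
      have hz : zMean (act (-1) X) = (-1 : ℝ) • zMean X := by rw [zMean_act]; simp
      refine absurd (uitStat_halfSpace_pos (X := act (-1) X) (i := last p) ?_ (Or.inl ?_))
        (not_lt.2 hmem.2)
      · rw [regularSet, Set.mem_ofPred_eq, hc]; exact hX.1
      · rw [hc, hz, ip_smul_right]; linarith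
    · exact absurd (uitStat_halfSpace_pos hX.1 (Or.inl h)) (not_lt.2 hmem.1)
  have h := measureReal_union_add_inter (μ := G) (s := N) (hm.preimage (measurable_act (-1)))
  rw [hdisj, hN] at h
  have := measureReal_le_one (μ := G) (s := N ∪ act (-1) ⁻¹' N)
  linarith

end nullLaw

/-! ### The null tail of the halfspace test -/

section halfSpaceTest

/-- The null rejection probability of the test against the halfspace. -/
noncomputable def nullTail (p n : ℕ) [NeZero p] (c : ℝ) : ℝ :=
  (sampleLaw n (0 : EuclideanSpace ℝ (Fin p)) 1).real {X | c ≤ uitStat (halfSpace p) X}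

variable [NeZero p]

lemma nullTail_strictAnti (hn : p < n) {c d : ℝ} (hc : 0 < c) (hcd : c < d) :
    nullTail p n d < nullTail p n c := by
  have hn1 : 1 ≤ n := by omega
  set G := sampleLaw n (0 : EuclideanSpace ℝ (Fin p)) 1
  have hO : IsOpen (regularSet p n ∩ uitStat (halfSpace p) ⁻¹' Set.Ioo c d) :=
    (continuousOn_uitStat_halfSpace hn1).isOpen_inter_preimage (isOpen_regularSet hn1) isOpen_Ioo
  have hne : (regularSet p n ∩ uitStat (halfSpace p) ⁻¹' Set.Ioo c d).Nonempty := by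
    obtain ⟨X₀, hX₀⟩ := nonempty_regularSet hn
    set e : EuclideanSpace ℝ (Fin p) := EuclideanSpace.single (last p) 1 with he
    have ha : 0 < ip (sampleCov X₀) e e := ip_self_pos hX₀ (by simp [he])
    -- The mean is scaled so that the statistic is the midpoint of `c` and `d`.
    obtain ⟨Y, hY, hYm⟩ := exists_zMean_eq hn1 X₀ (√((c + d) / 2 / ip (sampleCov X₀) e e) • e)
    have hYr : (sampleCov Y).PosDef := by rw [hY]; exact hX₀
    refine ⟨Y, hYr, ?_⟩
    have hv : uitStat (halfSpace p) Y = (c + d) / 2 := by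
      rw [uitStat_halfSpace hYr, hYm, halfStat_smul _ _ (Real.sqrt_nonneg _), hY,
        Real.sq_sqrt (by have := hc.trans hcd; positivity)]
      have : halfStat (sampleCov X₀) e = ip (sampleCov X₀) e e := by simp [halfStat, he]
      rw [this]
      field_simp
    rw [Set.mem_preimage, hv]
    constructor <;> linarith
  have hpos : 0 < G.real (regularSet p n ∩ uitStat (halfSpace p) ⁻¹' Set.Ioo c d) :=
    ENNReal.toReal_pos (hO.measure_pos G hne).ne' (measure_ne_top _ _)
  have hdisj : Disjoint {X : Fin n → EuclideanSpace ℝ (Fin p) | d ≤ uitStat (halfSpace p) X}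
      (regularSet p n ∩ uitStat (halfSpace p) ⁻¹' Set.Ioo c d) :=
    Set.disjoint_left.2 fun X h1 h2 => (not_lt.2 h1) h2.2.2
  calc nullTail p n d < nullTail p n d +
        G.real (regularSet p n ∩ uitStat (halfSpace p) ⁻¹' Set.Ioo c d) := by linarith
    _ = G.real ({X | d ≤ uitStat (halfSpace p) X} ∪
          (regularSet p n ∩ uitStat (halfSpace p) ⁻¹' Set.Ioo c d)) :=
        (measureReal_union hdisj hO.measurableSet).symm
    _ ≤ nullTail p n c := measureReal_mono (Set.union_subset
        (fun X (h : d ≤ _) => hcd.le.trans h) fun X h => h.2.1.le)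

lemma measure_uitStat_halfSpace_eq (hn : 1 ≤ n) {c : ℝ} (hc : 0 < c) :
    sampleLaw n (0 : EuclideanSpace ℝ (Fin p)) 1 {X | uitStat (halfSpace p) X = c} = 0 :=
  sampleLaw_absolutelyContinuous (volume_uitStat_halfSpace_eq hn hc)

lemma nullTail_eq_one_sub_cdf (hn : 1 ≤ n) {c : ℝ} (hc : 0 < c) :
    nullTail p n c = 1 - cdf ((sampleLaw n (0 : EuclideanSpace ℝ (Fin p)) 1).map
      (uitStat (halfSpace p))) c := by
  have hU := measurable_uitStat_halfSpace (p := p) hn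
  have := Measure.isProbabilityMeasure_map (μ := sampleLaw n (0 : EuclideanSpace ℝ (Fin p)) 1)
    hU.aemeasurable
  rw [cdf_eq_real, map_measureReal_apply hU measurableSet_Iic,
    ← probReal_compl_eq_one_sub (hU measurableSet_Iic), nullTail]
  refine measureReal_congr ?_
  have h := measure_eq_zero_iff_ae_notMem.1 (measure_uitStat_halfSpace_eq (p := p) hn hc)
  filter_upwards [h] with X hX
  refine propext ⟨fun h1 h2 => hX (le_antisymm h2 h1), fun h1 => ?_⟩
  exact (not_le.1 fun h2 => h1 h2).le

lemma exists_nullTail_eq (hn : p < n) {α : ℝ} (hα₀ : 0 < α) (hα₁ : α < 1)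
    (hα : p = 1 → α < 1 / 2) : ∃ c, 0 < c ∧ nullTail p n c = α := by
  have hn1 : 1 ≤ n := by omega
  have hU := measurable_uitStat_halfSpace (p := p) hn1
  set ν := (sampleLaw n (0 : EuclideanSpace ℝ (Fin p)) 1).map (uitStat (halfSpace p)) with hν
  have : IsProbabilityMeasure ν := Measure.isProbabilityMeasure_map hU.aemeasurable
  have h0 : cdf ν 0 < 1 - α := by
    have hval : cdf ν 0 = (sampleLaw n (0 : EuclideanSpace ℝ (Fin p)) 1).real
        {X | uitStat (halfSpace p) X ≤ 0} := by
      rw [cdf_eq_real, map_measureReal_apply hU measurableSet_Iic]; rfl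
    rw [hval]
    by_cases hp : p = 1
    · have := measure_uitStat_halfSpace_nonpos_le (p := p) hn
      linarith [hα hp]
    · have : (sampleLaw n (0 : EuclideanSpace ℝ (Fin p)) 1).real
          {X | uitStat (halfSpace p) X ≤ 0} = 0 := by
        rw [measureReal_eq_zero_iff, measure_eq_zero_iff_ae_notMem]
        filter_upwards [ae_uitStat_halfSpace_pos hn hp] with X hX h
        exact (not_lt.2 h) hX
      linarith
  obtain ⟨M, hM, hM0⟩ := (((tendsto_cdf_atTop ν).eventually
    (lt_mem_nhds (by linarith : 1 - α < 1))).and (Filter.eventually_gt_atTop 0)).exists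
  -- At `0` there may be an atom, but right continuity suffices there; at positive points there is
  -- none.
  have hcont : ContinuousOn (cdf ν) (Set.Icc 0 M) := by
    intro c hc
    rcases hc.1.eq_or_lt with rfl | hc0
    · exact ((cdf ν).right_continuous 0).mono Set.Icc_subset_Ici_self
    · refine ContinuousAt.continuousWithinAt ?_
      rw [(monotone_cdf ν).continuousAt_iff_leftLim_eq_rightLim, (cdf ν).rightLim_eq]
      have h1 := StieltjesFunction.measure_singleton (cdf ν) c
      rw [measure_cdf, hν, Measure.map_apply hU (measurableSet_singleton c)] at h1
      have h2 := measure_uitStat_halfSpace_eq (p := p) hn1 hc0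
      rw [show uitStat (n := n) (halfSpace p) ⁻¹' {c} = {X | uitStat (halfSpace p) X = c} from rfl,
        h2, ← hν, eq_comm, ENNReal.ofReal_eq_zero] at h1
      exact le_antisymm ((monotone_cdf ν).leftLim_le le_rfl) (by linarith)
  obtain ⟨c, hc, hcα⟩ := intermediate_value_Icc hM0.le hcont ⟨h0.le, hM.le⟩
  have hc0 : 0 < c := lt_of_le_of_ne hc.1 fun h => by
    rw [← h] at hcα; exact h0.ne hcα
  exact ⟨c, hc0, by rw [nullTail_eq_one_sub_cdf hn1 hc0, ← hν, hcα]; ring⟩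

lemma isLUB_power_halfSpace (hn : 1 ≤ n) {c : ℝ} (hc : 0 < c) :
    IsLUB {r | ∃ Sg : Matrix (Fin p) (Fin p) ℝ, Sg.PosDef ∧
      r = power n (halfSpace p) c 0 Sg} (nullTail p n c) := by
  have : {r | ∃ Sg : Matrix (Fin p) (Fin p) ℝ, Sg.PosDef ∧
      r = power n (halfSpace p) c 0 Sg} = {nullTail p n c} := by
    ext r
    constructor
    · rintro ⟨Sg, hSg, rfl⟩
      exact power_halfSpace_zero hn hc hSg
    · rintro rfl
      exact ⟨1, PosDef.one, (power_halfSpace_zero hn hc PosDef.one).symm⟩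
  rw [this]
  exact isLUB_singleton

end halfSpaceTest

/-! ### The supremum of the null rejection probabilities for a general cone -/

section coneTest

lemma power_mono (hn : 1 ≤ n) {K K' : Set (EuclideanSpace ℝ (Fin p))} (hK : IsClosedCone K)
    (hK' : IsClosedCone K') (hKK : K ⊆ K') (c : ℝ) (θ : EuclideanSpace ℝ (Fin p))
    (Sg : Matrix (Fin p) (Fin p) ℝ) : power n K c θ Sg ≤ power n K' c θ Sg :=
  measureReal_mono fun X (hX : c ≤ _) => hX.trans (uitStat_mono hn hK hK' hKK X)

variable [NeZero p]

/-- The linear map that fixes `a` and multiplies vectors with last coordinate zero by `ε`. -/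
noncomputable def squeeze (a : EuclideanSpace ℝ (Fin p)) (ε : ℝ) : Matrix (Fin p) (Fin p) ℝ :=
  ε • 1 + (1 - ε) • vecMulVec a.ofLp (Pi.single (last p) (a (last p))⁻¹)

lemma squeeze_apply (a z : EuclideanSpace ℝ (Fin p)) (ε : ℝ) :
    toEuclideanCLM (𝕜 := ℝ) (squeeze a ε) z =
      ε • z + ((1 - ε) * ((a (last p))⁻¹ * z (last p))) • a := by
  ext i
  simp [squeeze, ofLp_toEuclideanCLM, vecMulVec_mulVec]
  ring

/-- The matrix is `ε (1 - P) + P` for an idempotent `P`, so replacing `ε` by `ε⁻¹` inverts it. -/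
lemma isUnit_det_squeeze {a : EuclideanSpace ℝ (Fin p)} (ha : a (last p) ≠ 0) {ε : ℝ}
    (hε : ε ≠ 0) : IsUnit (squeeze a ε).det := by
  refine isUnit_det_of_right_inverse (B := squeeze a ε⁻¹) ?_
  have hP : vecMulVec a.ofLp (Pi.single (last p) (a (last p))⁻¹) *
      vecMulVec a.ofLp (Pi.single (last p) (a (last p))⁻¹) =
      vecMulVec a.ofLp (Pi.single (last p) (a (last p))⁻¹) := by
    rw [vecMulVec_mul_vecMulVec, single_dotProduct, inv_mul_cancel₀ ha, one_smul]
  rw [squeeze, squeeze]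
  generalize vecMulVec a.ofLp (Pi.single (last p) (a (last p))⁻¹) = P at hP
  simp only [add_mul, mul_add, smul_mul_smul, hP, Matrix.one_mul, Matrix.mul_one,
    mul_inv_cancel₀ hε, one_smul]
  rw [add_assoc, ← add_smul, ← add_smul]
  have : (1 - ε) * ε⁻¹ + (ε * (1 - ε⁻¹) + (1 - ε) * (1 - ε⁻¹)) = 0 := by
    field_simp; ring
  rw [this, zero_smul, add_zero]

/-- The images of `z` tend to a positive multiple of `a`, which is interior to the cone. -/
lemma eventually_squeeze_mem {K : Set (EuclideanSpace ℝ (Fin p))} (hK : IsClosedCone K)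
    {a z : EuclideanSpace ℝ (Fin p)} (haK : K ∈ nhds a) (ha : 0 < a (last p))
    (hz : 0 < z (last p)) :
    ∀ᶠ k : ℕ in Filter.atTop,
      toEuclideanCLM (𝕜 := ℝ) (squeeze a (1 / ((k : ℝ) + 1))) z ∈ K := by
  have hε := tendsto_one_div_add_atTop_nhds_zero_nat (𝕜 := ℝ)
  set r := (a (last p))⁻¹ * z (last p) with hr
  have hr0 : 0 < r := by positivity
  have h : Filter.Tendsto (fun k : ℕ =>
      r⁻¹ • toEuclideanCLM (𝕜 := ℝ) (squeeze a (1 / ((k : ℝ) + 1))) z) Filter.atTop (nhds a) := by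
    simp only [squeeze_apply, ← hr]
    have h1 : Filter.Tendsto (fun k : ℕ => r⁻¹ • ((1 / ((k : ℝ) + 1)) • z +
        ((1 - 1 / ((k : ℝ) + 1)) * r) • a)) Filter.atTop
        (nhds (r⁻¹ • ((0 : ℝ) • z + ((1 - 0) * r) • a))) :=
      ((hε.smul_const z).add (((hε.const_sub 1).mul_const r).smul_const a)).const_smul _
    convert h1 using 2
    rw [zero_smul, zero_add, sub_zero, one_mul, smul_smul, inv_mul_cancel₀ hr0.ne', one_smul]
  filter_upwards [h.eventually haK] with k hk
  have := hK.smul_mem r hr0 _ hk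
  rwa [smul_smul, mul_inv_cancel₀ hr0.ne', one_smul] at this

/-- The supremum of the null rejection probabilities for a cone with nonempty interior is the
null rejection probability for the halfspace. -/
lemma isLUB_power_cone (hn : p < n) {K : Set (EuclideanSpace ℝ (Fin p))} (hK : IsClosedCone K)
    (hKH : K ⊆ halfSpace p) {a : EuclideanSpace ℝ (Fin p)} (haK : K ∈ nhds a)
    (ha : 0 < a (last p)) {c : ℝ} (hc : 0 < c) :
    IsLUB {r | ∃ Sg : Matrix (Fin p) (Fin p) ℝ, Sg.PosDef ∧ r = power n K c 0 Sg}
      (nullTail p n c) := by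
  have hn1 : 1 ≤ n := by omega
  refine ⟨?_, fun b hb => ?_⟩
  · rintro _ ⟨Sg, hSg, rfl⟩
    exact (power_mono hn1 hK isClosedCone_halfSpace hKH c 0 Sg).trans
      (power_halfSpace_zero hn1 hc hSg).le
  set G := sampleLaw n (0 : EuclideanSpace ℝ (Fin p)) 1
  let D : ℕ → Matrix (Fin p) (Fin p) ℝ := fun k => squeeze a (1 / ((k : ℝ) + 1))
  have hD : ∀ k, IsUnit (D k).det := fun k =>
    isUnit_det_squeeze ha.ne' (by positivity)
  let A : ℕ → Set (Fin n → EuclideanSpace ℝ (Fin p)) := fun k => {X | c ≤ uitStat K (act (D k) X)}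
  have hA : ∀ k, G (A k) ≤ ENNReal.ofReal b := fun k => by
    have hpd : (D k * (D k)ᵀ).PosDef := by
      have := (posDef_conj_iff (S := 1) (hD k)).2 PosDef.one
      rwa [Matrix.mul_one] at this
    have := hb ⟨_, hpd, rfl⟩
    rw [power_mul_transpose (hD k)] at this
    exact (ENNReal.le_ofReal_iff_toReal_le (measure_ne_top _ _)
      (measureReal_nonneg.trans this)).2 this
  have hmono : Monotone fun N => ⋂ k ≥ N, A k := fun N N' h X hX => by
    simp only [Set.mem_iInter] at hX ⊢
    exact fun k hk => hX k (le_trans h hk)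
  -- A sample strictly rejected by the halfspace test is rejected by all but finitely many squeezed
  -- tests. The strict inequality leaves room to push the maximizer into the open halfspace; it
  -- costs nothing, since `c` is not an atom.
  have hsub : {X | c < uitStat (halfSpace p) X} ⊆ ⋃ N, ⋂ k ≥ N, A k := fun X hX => by
    have hX' : c < uitStat (halfSpace p) X := hX
    have hreg : (sampleCov X).PosDef := by
      by_contra h
      rw [uitStat_of_not_posDef hn1 h] at hX'
      exact hc.not_gt hX'
    obtain ⟨⟨y, hy, hyU⟩, -⟩ := isGreatest_uitStat hreg isClosedCone_halfSpace
    rw [← hyU] at hX'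
    set e : EuclideanSpace ℝ (Fin p) := EuclideanSpace.single (last p) 1 with he
    have hev : ∀ᶠ s : ℝ in nhdsWithin 0 (Set.Ioi 0),
        c < gain (sampleCov X) (zMean X) (y + s • e) := by
      refine nhdsWithin_le_nhds ?_
      have hcont : Continuous fun s : ℝ => gain (sampleCov X) (zMean X) (y + s • e) :=
        (continuous_gain _ _).comp (by fun_prop)
      exact hcont.continuousAt.eventually (lt_mem_nhds (by simpa using hX'))
    obtain ⟨s, hs, hs0⟩ := (hev.and self_mem_nhdsWithin).exists
    have hz : 0 < (y + s • e) (last p) := by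
      have h1 : 0 ≤ y (last p) := hy
      have h2 : (0 : ℝ) < s := hs0
      simp only [PiLp.add_apply, PiLp.smul_apply, he, EuclideanSpace.single, PiLp.single_apply,
        if_true, smul_eq_mul, mul_one]
      linarith
    obtain ⟨N, hN⟩ := Filter.eventually_atTop.1 (eventually_squeeze_mem hK haK ha hz)
    simp only [Set.mem_iUnion, Set.mem_iInter]
    exact ⟨N, fun k hk => (le_uitStat_act_iff hn1 hK hc (hD k) X).2
      ⟨hreg, _, hN k hk, hs.le⟩⟩
  have hle : G {X | c < uitStat (halfSpace p) X} ≤ ENNReal.ofReal b := by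
    refine (measure_mono hsub).trans ?_
    rw [hmono.measure_iUnion]
    exact iSup_le fun N => (measure_mono (Set.iInter₂_subset N le_rfl)).trans (hA N)
  have hb0 : 0 ≤ b := measureReal_nonneg.trans (hb ⟨1, PosDef.one, rfl⟩)
  have heq : nullTail p n c = G.real {X | c < uitStat (halfSpace p) X} := by
    refine measureReal_congr ?_
    have h := measure_eq_zero_iff_ae_notMem.1 (measure_uitStat_halfSpace_eq (p := p) hn1 hc)
    filter_upwards [h] with X hX
    exact propext ⟨fun h1 => lt_of_le_of_ne h1 fun h2 => hX h2.symm, fun h1 => le_of_lt h1⟩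
  rw [heq]
  exact ENNReal.toReal_le_of_le_ofReal hb0 hle

end coneTest

/-! ### Strict domination -/

section strict

/-- Samples at which the test for a closed cone does not reject form an open set, among the
samples with positive definite covariance matrix. -/
lemma isOpen_uitStat_lt (hn : 1 ≤ n) {K : Set (EuclideanSpace ℝ (Fin p))} (hK : IsClosedCone K)
    {c : ℝ} (hc : 0 < c) : IsOpen {X ∈ regularSet p n | uitStat K X < c} := by
  rw [isOpen_iff_mem_nhds]
  rintro X₀ ⟨hX₀, hU⟩
  have hcpt : IsCompact (K ∩ Metric.sphere 0 1) := (isCompact_sphere 0 1).inter_left hK.isClosed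
  -- The supremum of the gain over the ray of `z` is `max(0, ⟨x, z⟩)² / ⟨z, z⟩`, so `f < 0` says
  -- that it is below `c`. Compactness of the unit vectors of `K` makes this open condition uniform
  -- in `z`.
  let f : (Fin n → EuclideanSpace ℝ (Fin p)) × EuclideanSpace ℝ (Fin p) → ℝ := fun q =>
    max 0 (ip (sampleCov q.1) (zMean q.1) q.2) ^ 2 - c * ip (sampleCov q.1) q.2 q.2
  have hreg : regularSet p n ∈ nhds X₀ := (isOpen_regularSet hn).mem_nhds hX₀
  have hev : ∀ z ∈ K ∩ Metric.sphere 0 1, ∀ᶠ q : (Fin n → EuclideanSpace ℝ (Fin p)) ×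
      EuclideanSpace ℝ (Fin p) in nhds (X₀, z), f q < 0 := by
    rintro z ⟨hzK, hz⟩
    have hz0 : z ≠ 0 := by rintro rfl; simp at hz
    have ha := ip_self_pos hX₀ hz0
    have hval : f (X₀, z) < 0 := by
      change max 0 (ip (sampleCov X₀) (zMean X₀) z) ^ 2 - c * ip (sampleCov X₀) z z < 0
      rcases le_or_gt (ip (sampleCov X₀) (zMean X₀) z) 0 with h | h
      · rw [max_eq_left h]
        have := mul_pos hc ha
        linarith
      · rw [max_eq_right h.le]
        set b := ip (sampleCov X₀) (zMean X₀) z with hb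
        have hg := ((isGreatest_uitStat hX₀ hK).2 ⟨_, hK.smul_mem _ (div_pos h ha) z hzK,
          rfl⟩).trans_lt hU
        rw [gain, ip_smul_right, ip_smul_left, ip_smul_right, ← hb,
          show 2 * (b / ip (sampleCov X₀) z z * b) - b / ip (sampleCov X₀) z z *
            (b / ip (sampleCov X₀) z z * ip (sampleCov X₀) z z) =
            b ^ 2 / ip (sampleCov X₀) z z by field_simp; ring, div_lt_iff₀ ha] at hg
        linarith
    have hcont : ContinuousOn f (Prod.fst ⁻¹' regularSet p n) := by
      have h1 := continuousOn_ip (p := p) hn (Y := (Fin n → EuclideanSpace ℝ (Fin p)) ×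
        EuclideanSpace ℝ (Fin p)) continuous_fst (continuous_zMean.comp continuous_fst)
        continuous_snd
      have h2 := continuousOn_ip (p := p) hn (Y := (Fin n → EuclideanSpace ℝ (Fin p)) ×
        EuclideanSpace ℝ (Fin p)) continuous_fst continuous_snd continuous_snd
      exact (((continuous_const.max continuous_id).comp_continuousOn h1).pow 2).sub (continuousOn_const.mul h2)
    have hat : ContinuousAt f (X₀, z) :=
      hcont.continuousAt (continuous_fst.continuousAt.preimage_mem_nhds hreg)
    exact hat.eventually (gt_mem_nhds hval)
  have := hcpt.eventually_forall_of_forall_eventually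
    (P := fun X z => f (X, z) < 0) hev
  filter_upwards [this, hreg] with X hX hXr
  refine ⟨hXr, ?_⟩
  obtain ⟨⟨z, hz, hzU⟩, -⟩ := isGreatest_uitStat hXr hK
  rw [← hzU]
  rcases eq_or_ne z 0 with rfl | hz0
  · simpa [gain, ip] using hc
  have hnorm : 0 < ‖z‖ := norm_pos_iff.2 hz0
  have ha := ip_self_pos hXr hz0
  have hlt := hX (‖z‖⁻¹ • z) ⟨hK.smul_mem _ (by positivity) z hz, by
    simp [norm_smul, hnorm.ne']⟩
  simp only [f, ip_smul_left, ip_smul_right] at hlt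
  rw [← mul_zero ‖z‖⁻¹, ← mul_max_of_nonneg _ _ (by positivity : (0 : ℝ) ≤ ‖z‖⁻¹), mul_zero,
    show (‖z‖⁻¹ * max 0 (ip (sampleCov X) (zMean X) z)) ^ 2 -
      c * (‖z‖⁻¹ * (‖z‖⁻¹ * ip (sampleCov X) z z)) = (‖z‖⁻¹ ^ 2) *
      (max 0 (ip (sampleCov X) (zMean X) z) ^ 2 - c * ip (sampleCov X) z z) by ring] at hlt
  have hlt' := (pos_iff_neg_of_mul_neg hlt).1 (by positivity)
  have hb := le_max_right 0 (ip (sampleCov X) (zMean X) z)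
  rw [gain]
  set b := max 0 (ip (sampleCov X) (zMean X) z)
  set q := ip (sampleCov X) z z
  have : (2 * b - q) * q ≤ b ^ 2 := by nlinarith [sq_nonneg (b - q)]
  have : 2 * b - q < c := by
    by_contra hcon
    push Not at hcon
    nlinarith [mul_le_mul_of_nonneg_right hcon ha.le]
  linarith

/-- At a sample whose standardized mean lies in the halfspace but not in `K`, the two statistics
differ. Rescaling the mean places `c` strictly between them, and this persists on an open set. -/
lemma power_lt_power_halfSpace [NeZero p] (hn : p < n) {K : Set (EuclideanSpace ℝ (Fin p))}
    (hK : IsClosedCone K) (hKH : K ⊆ halfSpace p) (hne : K ≠ halfSpace p) {c : ℝ} (hc : 0 < c)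
    (θ : EuclideanSpace ℝ (Fin p)) :
    power n K c θ 1 < power n (halfSpace p) c θ 1 := by
  have hn1 : 1 ≤ n := by omega
  obtain ⟨x, hxH, hxK⟩ := Set.not_subset.1 fun h => hne (hKH.antisymm h)
  obtain ⟨X₀, hX₀⟩ := nonempty_regularSet hn
  obtain ⟨X₁, hX₁, hm₁⟩ := exists_zMean_eq hn1 X₀ x
  have hX₁r : (sampleCov X₁).PosDef := by rw [hX₁]; exact hX₀
  have hUH : uitStat (halfSpace p) X₁ = ip (sampleCov X₁) x x := by
    rw [uitStat_halfSpace hX₁r, hm₁, halfStat, min_eq_right (mem_halfSpace.1 hxH)]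
    ring
  obtain ⟨y, hy, hyU⟩ := (isGreatest_uitStat hX₁r hK).1
  have hlt : uitStat K X₁ < uitStat (halfSpace p) X₁ := by
    rw [hUH, ← hyU, hm₁, gain_eq_sqNorm_sub hX₁r, sqNorm_eq_ip, sqNorm_eq_ip]
    have := ip_self_pos hX₁r (x := x - y) (sub_ne_zero.2 fun h => hxK (h ▸ hy))
    linarith
  set u := uitStat K X₁
  set v := uitStat (halfSpace p) X₁
  have hu0 : 0 ≤ u := uitStat_nonneg hn1 X₁
  -- Chosen so that `t² (u + v) / 2 = c`, hence `t² u < c < t² v`.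
  set t := √(2 * c / (u + v)) with ht
  have huv : 0 < u + v := by linarith
  have ht0 : 0 < t := Real.sqrt_pos.2 (by positivity)
  have ht2 : t ^ 2 = 2 * c / (u + v) := Real.sq_sqrt (by positivity)
  have hcov := sampleCov_scaleMean hn1 t X₁
  have hreg : (sampleCov (scaleMean t X₁)).PosDef := by rwa [hcov]
  have hgtH : c < uitStat (halfSpace p) (scaleMean t X₁) := by
    rw [uitStat_halfSpace_scaleMean hn1 ht0.le, ht2, div_mul_eq_mul_div, lt_div_iff₀ huv]
    nlinarith
  have hltK : uitStat K (scaleMean t X₁) < c := by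
    obtain ⟨⟨z, hz, hzU⟩, -⟩ := isGreatest_uitStat hreg hK
    have h1 : gain (sampleCov X₁) (zMean X₁) (t⁻¹ • z) ≤ u :=
      (isGreatest_uitStat hX₁r hK).2 ⟨_, hK.smul_mem _ (by positivity) z hz, rfl⟩
    have h2 : gain (sampleCov (scaleMean t X₁)) (zMean (scaleMean t X₁)) z =
        t ^ 2 * gain (sampleCov X₁) (zMean X₁) (t⁻¹ • z) := by
      rw [hcov, zMean_scaleMean hn1]
      simp only [gain, ip_smul_left, ip_smul_right]
      field_simp
    rw [← hzU, h2]
    refine (mul_le_mul_of_nonneg_left h1 (by positivity)).trans_lt ?_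
    rw [ht2, div_mul_eq_mul_div, div_lt_iff₀ huv]
    nlinarith
  have hO : IsOpen ({X ∈ regularSet p n | uitStat K X < c} ∩
      (regularSet p n ∩ uitStat (halfSpace p) ⁻¹' Set.Ioi c)) :=
    (isOpen_uitStat_lt hn1 hK hc).inter ((continuousOn_uitStat_halfSpace hn1).isOpen_inter_preimage
      (isOpen_regularSet hn1) isOpen_Ioi)
  set O := {X ∈ regularSet p n | uitStat K X < c} ∩
      (regularSet p n ∩ uitStat (halfSpace p) ⁻¹' Set.Ioi c)
  have hpos : 0 < (sampleLaw n θ 1).real O := ENNReal.toReal_pos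
    (hO.measure_pos _ ⟨scaleMean t X₁, ⟨hreg, hltK⟩, hreg, hgtH⟩).ne' (measure_ne_top _ _)
  have hdisj : Disjoint {X | c ≤ uitStat K X} O :=
    Set.disjoint_left.2 fun X h1 h2 => (not_lt.2 h1) h2.1.2
  calc power n K c θ 1 < power n K c θ 1 + (sampleLaw n θ 1).real O := by linarith
    _ = (sampleLaw n θ 1).real ({X | c ≤ uitStat K X} ∪ O) :=
        (measureReal_union hdisj hO.measurableSet).symm
    _ ≤ power n (halfSpace p) c θ 1 := measureReal_mono (Set.union_subset
        (fun X (h : c ≤ _) => h.trans (uitStat_mono hn1 hK isClosedCone_halfSpace hKH X))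
        fun X h => show c ≤ _ from le_of_lt h.2.2)

end strict

/-! ### Critical values as solutions of one equation -/

section criticalValue

variable [NeZero p]

lemma isCriticalValue_iff {K : Set (EuclideanSpace ℝ (Fin p))}
    (hLUB : ∀ c : ℝ, 0 < c → IsLUB {r | ∃ Sg : Matrix (Fin p) (Fin p) ℝ, Sg.PosDef ∧
      r = power n K c 0 Sg} (nullTail p n c)) {α c : ℝ} :
    IsCriticalValue n K α c ↔ 0 < c ∧ nullTail p n c = α :=
  and_congr_right fun hc => ⟨fun h => (hLUB c hc).unique h, fun h => h ▸ hLUB c hc⟩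

lemma nullTail_injOn (hn : p < n) : Set.InjOn (nullTail p n) (Set.Ioi 0) :=
  StrictAntiOn.injOn fun _ hc _ _ hcd => nullTail_strictAnti hn hc hcd

end criticalValue

end OneSidedNormal

theorem proposition3p1 (p n : ℕ) [NeZero p] (hn : p < n)
    (C : ConvexCone ℝ (EuclideanSpace ℝ (Fin p)))
    (hclosed : IsClosed (C : Set (EuclideanSpace ℝ (Fin p))))
    (hopen : ∃ U : Set (EuclideanSpace ℝ (Fin p)), IsOpen U ∧ U.Nonempty ∧
      U ⊆ (C : Set (EuclideanSpace ℝ (Fin p))))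
    (hC : (C : Set (EuclideanSpace ℝ (Fin p))) ⊆ OneSidedNormal.halfSpace p)
    (α : ℝ) (hα₀ : 0 < α) (hα₁ : α < 1) :
    -- critical values of level `α` exist and are unique, for both problems
    ((p = 1 → α < 1 / 2) →
      (∃! c : ℝ, OneSidedNormal.IsCriticalValue n (C : Set (EuclideanSpace ℝ (Fin p))) α c) ∧
      (∃! c : ℝ, OneSidedNormal.IsCriticalValue n (OneSidedNormal.halfSpace p) α c)) ∧
    -- at equal level, the test against `C \ {0}` is dominated by the test against the halfspace
    ∀ c c' : ℝ, OneSidedNormal.IsCriticalValue n (C : Set (EuclideanSpace ℝ (Fin p))) α c →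
      OneSidedNormal.IsCriticalValue n (OneSidedNormal.halfSpace p) α c' →
      (∀ (θ : EuclideanSpace ℝ (Fin p)) (Sg : Matrix (Fin p) (Fin p) ℝ), Sg.PosDef →
        OneSidedNormal.power n (C : Set (EuclideanSpace ℝ (Fin p))) c θ Sg ≤
          OneSidedNormal.power n (OneSidedNormal.halfSpace p) c' θ Sg) ∧
      ((C : Set (EuclideanSpace ℝ (Fin p))) ≠ OneSidedNormal.halfSpace p →
        ∃ θ ∈ (C : Set (EuclideanSpace ℝ (Fin p))) \ {0}, ∃ Sg : Matrix (Fin p) (Fin p) ℝ,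
          Sg.PosDef ∧
          OneSidedNormal.power n (C : Set (EuclideanSpace ℝ (Fin p))) c θ Sg <
            OneSidedNormal.power n (OneSidedNormal.halfSpace p) c' θ Sg) := by
  open OneSidedNormal in
  have hn1 : 1 ≤ n := by omega
  obtain ⟨U, hU, ⟨a, haU⟩, hUC⟩ := hopen
  have hK : IsClosedCone (C : Set (EuclideanSpace ℝ (Fin p))) :=
    ⟨hclosed, ⟨a, hUC haU⟩, fun t ht z hz => C.smul_mem ht hz⟩
  have haC : (C : Set (EuclideanSpace ℝ (Fin p))) ∈ nhds a :=
    Filter.mem_of_superset (hU.mem_nhds haU) hUC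
  -- An interior point of `C` can be lowered slightly in the last coordinate without leaving the
  -- halfspace.
  have ha : 0 < a (last p) := by
    have hcont : Continuous fun s : ℝ => a - s • EuclideanSpace.single (last p) (1 : ℝ) := by
      fun_prop
    have hev : ∀ᶠ s : ℝ in nhdsWithin 0 (Set.Ioi 0),
        a - s • EuclideanSpace.single (last p) (1 : ℝ) ∈
          (C : Set (EuclideanSpace ℝ (Fin p))) :=
      nhdsWithin_le_nhds (hcont.continuousAt.eventually_mem (by simpa using haC))
    obtain ⟨s, hs, hs0⟩ := (hev.and self_mem_nhdsWithin).exists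
    have h1 := mem_halfSpace.1 (hC hs)
    have h2 : (0 : ℝ) < s := hs0
    simp only [PiLp.sub_apply, PiLp.smul_apply, EuclideanSpace.single, PiLp.single_apply,
      if_true, smul_eq_mul, mul_one] at h1
    linarith
  have hcritC : ∀ {c : ℝ}, IsCriticalValue n (C : Set (EuclideanSpace ℝ (Fin p))) α c ↔
      0 < c ∧ nullTail p n c = α :=
    isCriticalValue_iff fun c hc => isLUB_power_cone hn hK hC haC ha hc
  have hcritH : ∀ {c : ℝ}, IsCriticalValue n (halfSpace p) α c ↔ 0 < c ∧ nullTail p n c = α :=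
    isCriticalValue_iff fun c hc => isLUB_power_halfSpace hn1 hc
  refine ⟨fun hα => ?_, fun c c' hc hc' => ?_⟩
  · obtain ⟨c, hc0, hc⟩ := exists_nullTail_eq hn hα₀ hα₁ hα
    have huniq : ∀ d, 0 < d ∧ nullTail p n d = α → d = c := fun d hd =>
      nullTail_injOn hn hd.1 hc0 (hd.2.trans hc.symm)
    exact ⟨⟨c, hcritC.2 ⟨hc0, hc⟩, fun d hd => huniq d (hcritC.1 hd)⟩,
      ⟨c, hcritH.2 ⟨hc0, hc⟩, fun d hd => huniq d (hcritH.1 hd)⟩⟩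
  · rw [hcritC] at hc
    rw [hcritH] at hc'
    obtain rfl : c = c' := nullTail_injOn hn hc.1 hc'.1 (hc.2.trans hc'.2.symm)
    refine ⟨fun θ Sg _ => power_mono hn1 hK isClosedCone_halfSpace hC c θ Sg, fun hne => ?_⟩
    -- Strictness holds at every `θ` when `Σ = 1`; the interior point `a` is a nonzero element of
    -- `C`.
    refine ⟨a, ⟨hUC haU, fun h0 => ?_⟩, 1, PosDef.one,
      power_lt_power_halfSpace hn hK hC hne hc.1 a⟩
    rw [Set.mem_singleton_iff] at h0
    simp [h0] at ha
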